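/- Let $\mathrm{Vir}$ be the complex Virasoro algebra, with basis $\{d_i, c \mid i\in\mathbb Z\}$ and brackets $[d_i,d_j]=(j-i)d_{i+j}+\delta_{i,-j}\frac{i^3-i}{12}c$, $[c,d_i]=0$. Let $\mathrm{Vir}_+=\mathrm{span}\{d_i\mid i\ge 0\}$ and $\mathrm{Vir}_+^{(k)}=\mathrm{span}\{d_i\mid i>k\}$. For $\lambda\in\mathbb C^*$, $\alpha\in\mathbb C$, $h\in\mathbb C[t]$ let $\Omega(\lambda,\alpha,h)=\mathbb C[t,\partial]$ be the $\mathrm{Vir}$-module with $c=0$ and $$d_m(\partial^i f)=\lambda^m(\partial-m)^i\Big(\big(\partial+mh(t)-m(m-1)\alpha\tfrac{h(t)-h(\alpha)}{t-\alpha}\big)f(t)-m(t-m\alpha)f'(t)\Big)\qquad (f\in\mathbb C[t]),$$ and for $\mu\in\mathbb C^*$, $\beta\in\mathbb C$ let $\Omega(\mu,\beta)=\mathbb C[\partial]$ be the $\mathrm{Vir}$-module with $c=0$ and $d_k(\partial^n)=\mu^k(\partial-k)^n(\partial-\beta k)$. Let $m,n\ge 0$ be integers with $m+n\ge 1$, let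 $\lambda_i,\alpha_i,\mu_j,\beta_j\in\mathbb C^*$ and $h_i\in\mathbb C[t]$, and put $$T=\bigotimes_{i=1}^m\Omega(\lambda_i,\alpha_i,h_i)\otimes\bigotimes_{j=1}^n\Omega(\mu_j,\beta_j).$$ Let $V$ be any irreducible $\mathrm{Vir}$-module for which there is $K$ such that $d_k$ acts locally finitely on $V$ for every $k\ge K$. Then neither $T$ nor $T\otimes V$ is isomorphic to any of the following $\mathrm{Vir}$-modules. 1. (Mazorchuk–Zhao) $\mathrm{Ind}_\theta(N)=\mathrm{Ind}(N)/(c-\theta)\mathrm{Ind}(N)$ with $\mathrm{Ind}(N)=U(\mathrm{Vir})\otimes_{U(\mathrm{Vir}_+)}N$, where $\theta\in\mathbb C$ and $N$ is an irreducible $\mathrm{Vir}_+$-module such that, for some integer $k\ge 1$, $d_k$ acts injectively on $N$ and $d_iN=0$ for all $i>k$. 2. (Lu–Zhao) $A_b$, where $b\in\mathbb C$, $A$ is a module over the algebra $\mathbb C[t^{\pm1},D]$, $D=t\frac{d}{dt}$, of differential operators on $\mathbb C[t^{\pm1}]$, and $A_b=A$ with $c=0$ and $d_nv=(t^nD+nb\,t^n)v$;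 here one excludes the case $m=0$, $n=1$ for $T$, and the case $m=0$, $n=1$, $\dim V<\infty$ for $T\otimes V$ (for $\beta\in\mathbb C$, the module $\Omega(\mu,\beta)$ is itself of the form $A_b$). 3. (Liu–Lu–Zhao) $\mathcal N(M,\gamma)=M\otimes\mathbb C[t^{\pm1}]$, where $\gamma\in\mathbb C[t^{\pm1}]$, $k\ge 1$ is an integer, $M$ is an irreducible module over $\mathfrak a_k=\mathrm{Vir}_+/\mathrm{Vir}_+^{(k)}$ on which $\bar d_k$ acts injectively ($\bar d_i$ denotes the class of $d_i$), $c=0$, and $$d_m(v\otimes t^n)=\Big(n+\sum_{i=0}^k\frac{m^{i+1}}{(i+1)!}\bar d_i\Big)v\otimes t^{n+m}+v\otimes\gamma t^{m+n}.$$ In particular $T$ and $T\otimes V$ are not isomorphic to any irreducible module among these (with the exception stated in 2). -/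

import Mathlib

open scoped TensorProduct Polynomial LaurentPolynomial
noncomputable section

attribute [local instance] LieRing.ofAssociativeRing

/-- Labels of the basis `{d_i, c | i ∈ ℤ}` of the Virasoro algebra. -/
inductive VirIndex : Type
  | d (i : ℤ)
  | c

/-- The complex Virasoro algebra, as a vector space. -/
def Vir : Type := VirIndex →₀ ℂ

namespace Vir

instance : AddCommGroup Vir := inferInstanceAs (AddCommGroup (VirIndex →₀ ℂ))
instance : Module ℂ Vir := inferInstanceAs (Module ℂ (VirIndex →₀ ℂ))

/-- The basis of `Vir` consisting of the `d i` and of `c`. -/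
def basis : Module.Basis VirIndex ℂ Vir := Module.Basis.ofRepr (LinearEquiv.refl ℂ (VirIndex →₀ ℂ))

def d (i : ℤ) : Vir := basis (.d i)

def c : Vir := basis .c

/-- The brackets of basis elements:
`[d_i, d_j] = (j - i) d_{i+j} + δ_{i,-j} (i ^ 3 - i) / 12 c`, and `c` is central. -/
def basisBracket : VirIndex → VirIndex → Vir
  | .d i, .d j =>
      ((j : ℂ) - i) • d (i + j) + if i = -j then (((i : ℂ) ^ 3 - i) / 12) • c else 0
  | _, _ => 0

/-- The bilinear extension of `basisBracket`. -/
def bracketHom : Vir →ₗ[ℂ] Vir →ₗ[ℂ] Vir :=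
  basis.constr ℂ fun a => basis.constr ℂ fun b => basisBracket a b

theorem bracketHom_d_d (i j : ℤ) : bracketHom (d i) (d j) =
    ((j : ℂ) - i) • d (i + j) + if i = -j then (((i : ℂ) ^ 3 - i) / 12) • c else 0 := by
  simp [bracketHom, d, basisBracket]

theorem bracketHom_c_left (x : Vir) : bracketHom c x = 0 := by
  have : bracketHom c = 0 := by
    refine basis.ext fun a => ?_
    cases a <;> simp [bracketHom, c, basisBracket]
  rw [this]; rfl

theorem bracketHom_c_right (x : Vir) : bracketHom x c = 0 := by
  have : bracketHom.flip c = 0 := by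
    refine basis.ext fun a => ?_
    cases a <;> simp [bracketHom, c, basisBracket]
  exact LinearMap.congr_fun this x

theorem bracketHom_skew (x y : Vir) : bracketHom x y = - bracketHom y x := by
  have : bracketHom = - bracketHom.flip := by
    refine basis.ext fun a => basis.ext fun b => ?_
    rcases a with i | _ <;> rcases b with j | _
    · change bracketHom (d i) (d j) = - bracketHom (d j) (d i)
      rw [bracketHom_d_d, bracketHom_d_d, add_comm j i]
      by_cases h : i = -j
      · subst h; simp only [neg_neg, if_true]; push_cast; module
      · have h' : ¬ j = -i := fun h' => h (by omega)
        simp only [h, h', if_false]; module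
    · change bracketHom (d i) c = - bracketHom c (d i)
      rw [bracketHom_c_left, bracketHom_c_right, neg_zero]
    · change bracketHom c (d j) = - bracketHom (d j) c
      rw [bracketHom_c_left, bracketHom_c_right, neg_zero]
    · change bracketHom c c = - bracketHom c c
      rw [bracketHom_c_left, neg_zero]
  exact LinearMap.congr_fun (LinearMap.congr_fun this x) y

theorem bracketHom_self (x : Vir) : bracketHom x x = 0 := by
  have h : (2 : ℂ) • bracketHom x x = 0 := by
    rw [two_smul, ← eq_neg_iff_add_eq_zero]
    exact bracketHom_skew x x
  exact (smul_eq_zero.mp h).resolve_left two_ne_zero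

theorem bracketHom_jacobi (x y z : Vir) : bracketHom x (bracketHom y z) =
    bracketHom (bracketHom x y) z + bracketHom y (bracketHom x z) := by
  have key : ∀ a b e : VirIndex, bracketHom (basis a) (bracketHom (basis b) (basis e)) =
      bracketHom (bracketHom (basis a) (basis b)) (basis e) +
        bracketHom (basis b) (bracketHom (basis a) (basis e)) := by
    intro a b e
    rcases a with i | _ <;> rcases b with j | _ <;> rcases e with k | _
    · change bracketHom (d i) (bracketHom (d j) (d k)) =
        bracketHom (bracketHom (d i) (d j)) (d k) + bracketHom (d j) (bracketHom (d i) (d k))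
      have hc : ∀ (p : Prop) [Decidable p] (r : ℂ), ∃ s : ℂ,
          (if p then r • c else (0 : Vir)) = s • c := fun p _ r => by
        by_cases hp : p
        · exact ⟨r, by simp [hp]⟩
        · exact ⟨0, by simp [hp]⟩
      simp only [bracketHom_d_d, map_add, map_smul, LinearMap.add_apply, LinearMap.smul_apply,
        apply_ite (bracketHom (d i)), apply_ite (bracketHom (d j)), bracketHom_c_right, smul_zero, map_zero, ite_self, add_zero]
      have hb : bracketHom (if i = -j then (((i : ℂ) ^ 3 - i) / 12) • c else 0) (d k) = 0 := by
        obtain ⟨s, hs⟩ := hc (i = -j) (((i : ℂ) ^ 3 - i) / 12)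
        rw [hs, map_smul, LinearMap.smul_apply, bracketHom_c_left, smul_zero]
      rw [hb, add_zero]
      rw [show i + j + k = i + (j + k) by ring, show j + (i + k) = i + (j + k) by ring]
      by_cases h : i + j + k = 0
      · have hk : k = -i - j := by omega
        subst hk
        rw [if_pos (by ring), if_pos (by ring), if_pos (by ring)]
        push_cast
        module
      · rw [if_neg (by omega), if_neg (by omega), if_neg (by omega)]
        push_cast
        module
    all_goals
      simp only [show basis VirIndex.c = c from rfl, bracketHom_c_left, bracketHom_c_right, map_zero,
        LinearMap.zero_apply, add_zero]
  have span (P : Vir → Prop) (hb : ∀ a, P (basis a)) (h0 : P 0)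
      (hadd : ∀ u v, P u → P v → P (u + v)) (hsmul : ∀ (r : ℂ) u, P u → P (r • u)) (u : Vir) :
      P u := by
    have hu : u ∈ Submodule.span ℂ (Set.range basis) := basis.mem_span u
    induction hu using Submodule.span_induction with
    | mem u hu => obtain ⟨a, rfl⟩ := hu; exact hb a
    | zero => exact h0
    | add u v _ _ hu hv => exact hadd u v hu hv
    | smul r u _ hu => exact hsmul r u hu
  refine span (fun x => bracketHom x (bracketHom y z) =
    bracketHom (bracketHom x y) z + bracketHom y (bracketHom x z)) (fun a => ?_) (by simp)
    (fun u v hu hv => ?_) (fun r u hu => ?_) x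
  · refine span (fun y => bracketHom (basis a) (bracketHom y z) =
      bracketHom (bracketHom (basis a) y) z + bracketHom y (bracketHom (basis a) z))
      (fun b => ?_) (by simp) (fun u v hu hv => ?_) (fun r u hu => ?_) y
    · refine span (fun z => bracketHom (basis a) (bracketHom (basis b) z) =
        bracketHom (bracketHom (basis a) (basis b)) z +
          bracketHom (basis b) (bracketHom (basis a) z)) (fun e => key a b e) (by simp) (fun u v hu hv => ?_) (fun r u hu => ?_) z
      · simp only [map_add, hu, hv]; abel
      · simp only [map_smul, hu, smul_add]
    · simp only [map_add, LinearMap.add_apply, hu, hv]; abel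
    · simp only [map_smul, LinearMap.smul_apply, hu, smul_add]
  · simp only [map_add, LinearMap.add_apply, hu, hv]; abel
  · simp only [map_smul, LinearMap.smul_apply, hu, smul_add]

/-- The Lie bracket of the Virasoro algebra. -/
instance : LieRing Vir where
  bracket x y := bracketHom x y
  add_lie x y z := by simp only [map_add, LinearMap.add_apply]
  lie_add x y z := by simp only [map_add]
  lie_self := bracketHom_self
  leibniz_lie := bracketHom_jacobi

instance : LieAlgebra ℂ Vir where
  lie_smul r x y := map_smul (bracketHom x) r y

theorem lie_d_d (i j : ℤ) : ⁅d i, d j⁆ =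
    ((j : ℂ) - i) • d (i + j) + if i = -j then (((i : ℂ) ^ 3 - i) / 12) • c else 0 :=
  bracketHom_d_d i j

theorem c_lie (x : Vir) : ⁅c, x⁆ = 0 := bracketHom_c_left x

theorem lie_c (x : Vir) : ⁅x, c⁆ = 0 := bracketHom_c_right x

/-- The representation of `Vir` on which `d_i` acts as `D i` and `c` acts as zero. -/
def repOfOperators {W : Type*} [AddCommGroup W] [Module ℂ W] (D : ℤ → Module.End ℂ W)
    (hD : ∀ i j w, D i (D j w) - D j (D i w) = ((j : ℂ) - i) • D (i + j) w) :
    Vir →ₗ⁅ℂ⁆ Module.End ℂ W :=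
  let F : Vir →ₗ[ℂ] Module.End ℂ W := basis.constr ℂ fun a =>
    match a with
    | .d i => D i
    | .c => 0
  { F with
    map_lie' := by
      have hd (i : ℤ) : F (d i) = D i := by simp [F, d]
      have hc : F c = 0 := by simp [F, c]
      have : bracketHom.compr₂ F = (LieModule.toEnd ℂ (Module.End ℂ W) (Module.End ℂ W) :
          Module.End ℂ W →ₗ[ℂ] Module.End ℂ (Module.End ℂ W)).compl₁₂ F F := by
        refine basis.ext fun a => basis.ext fun b => ?_
        rcases a with i | _ <;> rcases b with j | _
        · change F (bracketHom (d i) (d j)) = ⁅F (d i), F (d j)⁆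
          rw [bracketHom_d_d, map_add, map_smul, apply_ite F, map_smul, hc, hd, hd, hd, smul_zero,
            map_zero, ite_self, add_zero]
          ext w
          exact (hD i j w).symm
        · change F (bracketHom (d i) c) = ⁅F (d i), F c⁆
          rw [bracketHom_c_right, hc, map_zero, lie_zero]
        · change F (bracketHom c (d j)) = ⁅F c, F (d j)⁆
          rw [bracketHom_c_left, hc, map_zero, zero_lie]
        · change F (bracketHom c c) = ⁅F c, F c⁆
          rw [bracketHom_c_left, hc, map_zero, lie_zero]
      intro x y
      exact LinearMap.congr_fun (LinearMap.congr_fun this x) y }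

section repOfOperators

variable {W : Type*} [AddCommGroup W] [Module ℂ W] (D : ℤ → Module.End ℂ W)
    (hD : ∀ i j w, D i (D j w) - D j (D i w) = ((j : ℂ) - i) • D (i + j) w)

theorem repOfOperators_d (i : ℤ) : repOfOperators D hD (d i) = D i := by
  change (basis.constr ℂ _) (d i) = D i
  simp [d]

theorem repOfOperators_c : repOfOperators D hD c = 0 := by
  change (basis.constr ℂ _) c = 0
  simp [c]

end repOfOperators

end Vir

section PiTensorProduct

variable {L : Type*} [LieRing L] [LieAlgebra ℂ L] {ι : Type*} [Fintype ι] [DecidableEq ι]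
  (s : ι → Type*) [∀ i, AddCommGroup (s i)] [∀ i, Module ℂ (s i)] [∀ i, LieRingModule L (s i)]
  [∀ i, LieModule ℂ L (s i)]

/-- The action of `x` on `⨂ i, s i` by the Leibniz rule: the sum over `i` of the operators that
act by `x` on the `i`-th factor and by the identity on the others. -/
def piTensorAction (x : L) : Module.End ℂ (⨂[ℂ] i, s i) :=
  ∑ i, PiTensorProduct.map (Function.update (fun j => (1 : Module.End ℂ (s j))) i
    (LieModule.toEnd ℂ L (s i) x))

/-- `piTensorAction` as a representation. -/
def piTensorRep : L →ₗ⁅ℂ⁆ Module.End ℂ (⨂[ℂ] i, s i) where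
  toFun := piTensorAction s
  map_add' x y := by
    simp only [piTensorAction, map_add, PiTensorProduct.map_update_add, Finset.sum_add_distrib]
  map_smul' r x := by
    simp only [piTensorAction, map_smul, PiTensorProduct.map_update_smul, Finset.smul_sum,
      RingHom.id_apply]
  map_lie' {x y} := by
    have hcomm : ∀ i j, i ≠ j → ⁅PiTensorProduct.map (Function.update
        (fun j => (1 : Module.End ℂ (s j))) i (LieModule.toEnd ℂ L (s i) x)),
        PiTensorProduct.map (Function.update
        (fun j => (1 : Module.End ℂ (s j))) j (LieModule.toEnd ℂ L (s j) y))⁆ = 0 := by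
      intro i j hij
      rw [Ring.lie_def, ← PiTensorProduct.map_mul, ← PiTensorProduct.map_mul, sub_eq_zero]
      congr 1
      funext k
      by_cases hi : k = i
      · subst hi; simp [Function.update_of_ne hij]
      · simp [Function.update_of_ne hi]
    have hself : ∀ i, ⁅PiTensorProduct.map (Function.update
        (fun j => (1 : Module.End ℂ (s j))) i (LieModule.toEnd ℂ L (s i) x)),
        PiTensorProduct.map (Function.update
        (fun j => (1 : Module.End ℂ (s j))) i (LieModule.toEnd ℂ L (s i) y))⁆ =
        PiTensorProduct.map (Function.update
        (fun j => (1 : Module.End ℂ (s j))) i (LieModule.toEnd ℂ L (s i) ⁅x, y⁆)) := by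
      intro i
      have hupd (A B : Module.End ℂ (s i)) : (fun k =>
          Function.update (fun j => (1 : Module.End ℂ (s j))) i A k *
            Function.update (fun j => (1 : Module.End ℂ (s j))) i B k) =
          Function.update (fun j => (1 : Module.End ℂ (s j))) i (A * B) := by
        funext k
        by_cases hi : k = i
        · subst hi; simp
        · simp [Function.update_of_ne hi]
      rw [Ring.lie_def, ← PiTensorProduct.map_mul, ← PiTensorProduct.map_mul, hupd, hupd,
        LieHom.map_lie, Ring.lie_def, sub_eq_add_neg (_ * _), ← neg_one_smul ℂ (_ * _),
        PiTensorProduct.map_update_add, PiTensorProduct.map_update_smul]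
      module
    simp only [piTensorAction]
    rw [sum_lie]
    refine Finset.sum_congr rfl fun i _ => ?_
    rw [lie_sum, Finset.sum_eq_single i (fun j _ hj => hcomm i j hj.symm) (by simp), hself]

instance piTensorLieRingModule : LieRingModule L (⨂[ℂ] i, s i) :=
  LieRingModule.compLieHom _ (piTensorRep (L := L) s)

instance piTensorLieModule : LieModule ℂ L (⨂[ℂ] i, s i) :=
  LieModule.compLieHom _ (piTensorRep (L := L) s)

theorem lie_tprod (x : L) (v : ∀ i, s i) : ⁅x, PiTensorProduct.tprod ℂ v⁆ =
    ∑ i, PiTensorProduct.tprod ℂ (Function.update v i ⁅x, v i⁆) := by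
  change piTensorAction s x _ = _
  rw [piTensorAction, LinearMap.sum_apply]
  refine Finset.sum_congr rfl fun i _ => ?_
  rw [PiTensorProduct.map_tprod]
  congr 1
  funext j
  by_cases hj : j = i
  · subst hj; simp
  · simp [Function.update_of_ne hj]

end PiTensorProduct

section Omega

open Polynomial

/-- `(h(t) - h(α)) / (t - α)` -/
def diffQuot (α : ℂ) (h : ℂ[X]) : ℂ[X] := (h - C (h.eval α)) /ₘ (X - C α)

theorem mul_diffQuot (α : ℂ) (h : ℂ[X]) :
    (X - C α) * diffQuot α h = h - C (h.eval α) := by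
  rw [diffQuot, mul_divByMonic_eq_iff_isRoot]
  simp

/-- `f ↦ (m h(t) - m (m - 1) α (h(t) - h(α)) / (t - α)) f(t) - m (t - m α) f'(t)`. -/
def omegaTripleCoeff (α : ℂ) (h : ℂ[X]) (m : ℤ) : ℂ[X] →ₗ[ℂ] ℂ[X] :=
  LinearMap.mulLeft ℂ (C (m : ℂ) * h - C ((m : ℂ) * (m - 1) * α) * diffQuot α h) -
    LinearMap.mulLeft ℂ (C (m : ℂ) * (X - C ((m : ℂ) * α))) ∘ₗ derivative

/-- The operator of `d_m` on `ℂ[t, ∂]`: `∂ ^ i f` is sent to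
`l ^ m (∂ - m) ^ i ((∂ + m h - m (m - 1) α (h - h(α)) / (t - α)) f - m (t - m α) f')`. -/
def omegaTripleAction (l : ℂˣ) (α : ℂ) (h : ℂ[X]) (m : ℤ) : Module.End ℂ ℂ[X][X] :=
  Polynomial.lsum fun i =>
    { toFun := fun f => ((l ^ m : ℂˣ) : ℂ) • ((X - C (C (m : ℂ))) ^ i *
        (X * C f + C (omegaTripleCoeff α h m f)))
      map_add' := fun f g => by simp only [map_add, mul_add, smul_add]; abel
      map_smul' := fun r f => by
        simp only [map_smul, RingHom.id_apply, ← smul_C, smul_smul, mul_smul_comm, ← smul_add,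
          mul_comm r] }

theorem omegaTripleAction_C_mul_X_pow (l : ℂˣ) (α : ℂ) (h : ℂ[X]) (m : ℤ) (i : ℕ) (f : ℂ[X]) :
    omegaTripleAction l α h m (C f * X ^ i) = ((l ^ m : ℂˣ) : ℂ) • ((X - C (C (m : ℂ))) ^ i *
        (X * C f + C (omegaTripleCoeff α h m f))) := by
  rw [C_mul_X_pow_eq_monomial]
  simp only [omegaTripleAction, lsum_apply]
  rw [sum_monomial_index]
  · rfl
  · exact map_zero _

theorem omegaTripleAction_sub_pow_mul (l : ℂˣ) (α : ℂ) (h : ℂ[X]) (m n : ℤ) (i : ℕ) (P : ℂ[X][X]) :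
    omegaTripleAction l α h m ((X - C (C (n : ℂ))) ^ i * P) =
      (X - C (C ((m : ℂ) + n))) ^ i * omegaTripleAction l α h m P := by
  have hX (P : ℂ[X][X]) : omegaTripleAction l α h m (X * P) =
      (X - C (C (m : ℂ))) * omegaTripleAction l α h m P := by
    induction P using Polynomial.induction_on' with
    | add p q hp hq => rw [mul_add, map_add, hp, hq, map_add, mul_add]
    | monomial j f =>
      rw [← C_mul_X_pow_eq_monomial, show X * (C f * X ^ j) = C f * X ^ (j + 1) by ring,
        omegaTripleAction_C_mul_X_pow, omegaTripleAction_C_mul_X_pow, mul_smul_comm, pow_succ']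
      ring_nf
  have h1 (P : ℂ[X][X]) : omegaTripleAction l α h m ((X - C (C (n : ℂ))) * P) =
      (X - C (C ((m : ℂ) + n))) * omegaTripleAction l α h m P := by
    have : C (C (n : ℂ)) * P = (n : ℂ) • P := by
      rw [← smul_eq_C_mul, ← algebraMap_eq, algebraMap_smul]
    rw [sub_mul, map_sub, hX, this, map_smul, map_add, map_add, sub_mul, sub_mul, add_mul]
    have : C (C (n : ℂ)) * omegaTripleAction l α h m P = (n : ℂ) • omegaTripleAction l α h m P := by
      rw [← smul_eq_C_mul, ← algebraMap_eq, algebraMap_smul]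
    rw [this]
    abel
  induction i with
  | zero => simp
  | succ i ih => rw [pow_succ', mul_assoc, h1, ih, pow_succ', mul_assoc]

theorem omegaTripleCoeff_comm (α : ℂ) (h : ℂ[X]) (m n : ℤ) (f : ℂ[X]) :
    omegaTripleCoeff α h m (omegaTripleCoeff α h n f) - omegaTripleCoeff α h n (omegaTripleCoeff α h m f)
      - C (m : ℂ) * omegaTripleCoeff α h m f + C (n : ℂ) * omegaTripleCoeff α h n f =
      C ((n : ℂ) - m) * omegaTripleCoeff α h (m + n) f := by
  have hh : h = (X - C α) * diffQuot α h + C (h.eval α) := by rw [mul_diffQuot]; ring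
  obtain ⟨a, ha⟩ : ∃ a, a = h.eval α := ⟨_, rfl⟩
  rw [← ha] at hh
  generalize hq : diffQuot α h = q at hh
  simp only [omegaTripleCoeff, hq]
  subst hh
  simp
  ring

theorem omegaTripleAction_bracket (l : ℂˣ) (α : ℂ) (h : ℂ[X]) (m n : ℤ) (P : ℂ[X][X]) :
    omegaTripleAction l α h m (omegaTripleAction l α h n P) -
      omegaTripleAction l α h n (omegaTripleAction l α h m P) =
      ((n : ℂ) - m) • omegaTripleAction l α h (m + n) P := by
  induction P using Polynomial.induction_on' with
  | add p q hp hq => simp only [map_add, smul_add, ← hp, ← hq]; abel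
  | monomial j f =>
    have key (m n : ℤ) : omegaTripleAction l α h m (omegaTripleAction l α h n (C f * X ^ j)) =
        ((l ^ (m + n) : ℂˣ) : ℂ) • ((X - C (C ((m : ℂ) + n))) ^ j *
          ((X - C (C (m : ℂ))) * (X * C f + C (omegaTripleCoeff α h m f)) +
            (X * C (omegaTripleCoeff α h n f) +
              C (omegaTripleCoeff α h m (omegaTripleCoeff α h n f))))) := by
      have h0 (g : ℂ[X]) := omegaTripleAction_C_mul_X_pow l α h m 0 g
      have h1 (g : ℂ[X]) := omegaTripleAction_C_mul_X_pow l α h m 1 g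
      simp only [pow_one, pow_zero, one_mul, mul_one] at h0 h1
      rw [omegaTripleAction_C_mul_X_pow, map_smul, omegaTripleAction_sub_pow_mul,
        map_add (omegaTripleAction l α h m), mul_comm X, h1, h0, ← smul_add, mul_smul_comm, smul_smul, zpow_add, Units.val_mul,
        mul_comm ((l ^ n : ℂˣ) : ℂ), mul_comm (C f) X]
    rw [← C_mul_X_pow_eq_monomial, key, key, omegaTripleAction_C_mul_X_pow, add_comm n m,
      add_comm (n : ℂ) m, ← smul_sub, smul_comm ((n : ℂ) - m), ← mul_sub]
    congr 1
    have hs (r : ℂ) (Q : ℂ[X][X]) : r • Q = C (C r) * Q := by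
      rw [← smul_eq_C_mul, ← algebraMap_eq, algebraMap_smul]
    have hcm := congrArg (C : ℂ[X] → ℂ[X][X]) (omegaTripleCoeff_comm α h m n f)
    simp only [map_add, map_sub, map_mul] at hcm
    rw [hs, Int.cast_add]
    simp only [map_add, map_sub]
    linear_combination (X - (C (C (m : ℂ)) + C (C (n : ℂ)))) ^ j * hcm


/-- The space `ℂ[t, ∂]` of `Ω(l, α, h)`, as polynomials in `∂` with coefficients in `ℂ[t]`. -/
def OmegaTriple (_l : ℂˣ) (_α : ℂ) (_h : ℂ[X]) : Type := ℂ[X][X]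

instance (l : ℂˣ) (α : ℂ) (h : ℂ[X]) : AddCommGroup (OmegaTriple l α h) :=
  inferInstanceAs (AddCommGroup ℂ[X][X])

instance (l : ℂˣ) (α : ℂ) (h : ℂ[X]) : Module ℂ (OmegaTriple l α h) :=
  inferInstanceAs (Module ℂ ℂ[X][X])

/-- The representation `Ω(l, α, h)`; here `c` acts as zero. -/
def omegaTripleRep (l : ℂˣ) (α : ℂ) (h : ℂ[X]) : Vir →ₗ⁅ℂ⁆ Module.End ℂ (OmegaTriple l α h) :=
  Vir.repOfOperators (W := OmegaTriple l α h) (omegaTripleAction l α h) (omegaTripleAction_bracket l α h)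

instance (l : ℂˣ) (α : ℂ) (h : ℂ[X]) : LieRingModule Vir (OmegaTriple l α h) :=
  LieRingModule.compLieHom _ (omegaTripleRep l α h)

instance (l : ℂˣ) (α : ℂ) (h : ℂ[X]) : LieModule ℂ Vir (OmegaTriple l α h) :=
  LieModule.compLieHom _ (omegaTripleRep l α h)

theorem OmegaTriple.lie_d (l : ℂˣ) (α : ℂ) (h : ℂ[X]) (m : ℤ) (P : OmegaTriple l α h) :
    ⁅Vir.d m, P⁆ = (omegaTripleAction l α h m P : OmegaTriple l α h) :=
  LinearMap.congr_fun (Vir.repOfOperators_d (W := OmegaTriple l α h) _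
    (omegaTripleAction_bracket l α h) m) P

theorem OmegaTriple.lie_c (l : ℂˣ) (α : ℂ) (h : ℂ[X]) (P : OmegaTriple l α h) : ⁅Vir.c, P⁆ = 0 :=
  LinearMap.congr_fun (Vir.repOfOperators_c (W := OmegaTriple l α h) _
    (omegaTripleAction_bracket l α h)) P

/-- The operator of `d_k` on `ℂ[∂]`: `∂ ^ n ↦ μ ^ k (∂ - k) ^ n (∂ - β k)`. -/
def omegaPairAction (μ : ℂˣ) (β : ℂ) (k : ℤ) : Module.End ℂ ℂ[X] :=
  ((μ ^ k : ℂˣ) : ℂ) • (LinearMap.mulRight ℂ (X - C (β * k)) ∘ₗ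
    (aeval (X - C (k : ℂ)) : ℂ[X] →ₐ[ℂ] ℂ[X]).toLinearMap)

theorem omegaPairAction_apply (μ : ℂˣ) (β : ℂ) (k : ℤ) (f : ℂ[X]) :
    omegaPairAction μ β k f =
      ((μ ^ k : ℂˣ) : ℂ) • (f.comp (X - C (k : ℂ)) * (X - C (β * k))) := rfl

theorem omegaPairAction_X_pow (μ : ℂˣ) (β : ℂ) (k : ℤ) (n : ℕ) :
    omegaPairAction μ β k (X ^ n) =
      ((μ ^ k : ℂˣ) : ℂ) • ((X - C (k : ℂ)) ^ n * (X - C (β * k))) := by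
  simp [omegaPairAction_apply]

theorem omegaPairAction_bracket (μ : ℂˣ) (β : ℂ) (m n : ℤ) (f : ℂ[X]) :
    omegaPairAction μ β m (omegaPairAction μ β n f) -
      omegaPairAction μ β n (omegaPairAction μ β m f) =
      ((n : ℂ) - m) • omegaPairAction μ β (m + n) f := by
  simp only [omegaPairAction_apply, smul_comp, mul_comp, comp_assoc, sub_comp, X_comp, C_comp,
    smul_mul_assoc, smul_smul, zpow_add, Units.val_mul]
  have h1 : (X - C (m : ℂ) - C (n : ℂ) : ℂ[X]) = X - C (((m + n : ℤ)) : ℂ) := by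
    push_cast; rw [C_add]; ring
  have h2 : (X - C (n : ℂ) - C (m : ℂ) : ℂ[X]) = X - C (((m + n : ℤ)) : ℂ) := by
    push_cast; rw [C_add]; ring
  rw [h1, h2]
  simp only [smul_eq_C_mul, C_mul, C_sub]
  push_cast
  rw [C_add]
  ring

/-- The space `ℂ[∂]` of `Ω(μ, β)`. -/
def OmegaPair (_μ : ℂˣ) (_β : ℂ) : Type := ℂ[X]

instance (μ : ℂˣ) (β : ℂ) : AddCommGroup (OmegaPair μ β) := inferInstanceAs (AddCommGroup ℂ[X])

instance (μ : ℂˣ) (β : ℂ) : Module ℂ (OmegaPair μ β) := inferInstanceAs (Module ℂ ℂ[X])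

/-- The representation `Ω(μ, β)`; here `c` acts as zero. -/
def omegaPairRep (μ : ℂˣ) (β : ℂ) : Vir →ₗ⁅ℂ⁆ Module.End ℂ (OmegaPair μ β) :=
  Vir.repOfOperators (W := OmegaPair μ β) (omegaPairAction μ β) (omegaPairAction_bracket μ β)

instance (μ : ℂˣ) (β : ℂ) : LieRingModule Vir (OmegaPair μ β) :=
  LieRingModule.compLieHom _ (omegaPairRep μ β)

instance (μ : ℂˣ) (β : ℂ) : LieModule ℂ Vir (OmegaPair μ β) :=
  LieModule.compLieHom _ (omegaPairRep μ β)

theorem OmegaPair.lie_d (μ : ℂˣ) (β : ℂ) (k : ℤ) (f : OmegaPair μ β) :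
    ⁅Vir.d k, f⁆ = (omegaPairAction μ β k f : OmegaPair μ β) :=
  LinearMap.congr_fun (Vir.repOfOperators_d (W := OmegaPair μ β) _ (omegaPairAction_bracket μ β) k) f

theorem OmegaPair.lie_c (μ : ℂˣ) (β : ℂ) (f : OmegaPair μ β) : ⁅Vir.c, f⁆ = 0 :=
  LinearMap.congr_fun (Vir.repOfOperators_c (W := OmegaPair μ β) _ (omegaPairAction_bracket μ β)) f

end Omega

/-- `⨂ᵢ Ω(lᵢ, αᵢ, hᵢ) ⊗ ⨂ⱼ Ω(μⱼ, βⱼ)`. -/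
abbrev OmegaTensor {m n : ℕ} (l : Fin m → ℂˣ) (α : Fin m → ℂ) (h : Fin m → ℂ[X])
    (μ : Fin n → ℂˣ) (β : Fin n → ℂ) : Type :=
  (⨂[ℂ] i, OmegaTriple (l i) (α i) (h i)) ⊗[ℂ] (⨂[ℂ] j, OmegaPair (μ j) (β j))

/-- The operator `t d/dt` on Laurent polynomials. -/
def euler : Module.End ℂ ℂ[T;T⁻¹] :=
  (AddMonoidAlgebra.basis ℤ ℂ).constr ℂ fun n => (n : ℂ) • LaurentPolynomial.T n

theorem euler_T (n : ℤ) : euler (LaurentPolynomial.T n) = (n : ℂ) • LaurentPolynomial.T n := by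
  have : (LaurentPolynomial.T n : ℂ[T;T⁻¹]) = AddMonoidAlgebra.basis ℤ ℂ n := by
    rw [AddMonoidAlgebra.basis_apply]; rfl
  rw [this, euler, Module.Basis.constr_basis, ← this]

theorem euler_T_mul (n : ℤ) (f : ℂ[T;T⁻¹]) : euler (LaurentPolynomial.T n * f) =
    LaurentPolynomial.T n * euler f + (n : ℂ) • (LaurentPolynomial.T n * f) := by
  induction f using LaurentPolynomial.induction_on' with
  | add p q hp hq => simp only [mul_add, map_add, hp, hq, smul_add]; abel
  | C_mul_T k a =>
    have hC (g : ℂ[T;T⁻¹]) : LaurentPolynomial.C a * g = a • g := by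
      rw [LaurentPolynomial.smul_eq_C_mul]
    rw [hC, mul_smul_comm, map_smul, map_smul, euler_T, ← LaurentPolynomial.T_add, euler_T]
    simp only [mul_smul_comm, ← LaurentPolynomial.T_add]
    push_cast
    module

/-- The algebra `ℂ[t, t⁻¹, t d/dt]` of differential operators on Laurent polynomials. -/
def laurentDiffOps : Subalgebra ℂ (Module.End ℂ ℂ[T;T⁻¹]) :=
  Algebra.adjoin ℂ (insert euler (Set.range fun f : ℂ[T;T⁻¹] => LinearMap.mulLeft ℂ f))

/-- The operator of multiplication by `t ^ n`. -/
def opT (n : ℤ) : laurentDiffOps :=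
  ⟨LinearMap.mulLeft ℂ (LaurentPolynomial.T n),
    Algebra.subset_adjoin (Set.mem_insert_of_mem _ ⟨_, rfl⟩)⟩

/-- The operator `t d/dt`. -/
def opD : laurentDiffOps := ⟨euler, Algebra.subset_adjoin (Set.mem_insert _ _)⟩

theorem opT_mul (m n : ℤ) : opT m * opT n = opT (m + n) := by
  refine Subtype.ext (LinearMap.ext fun f => ?_)
  change LaurentPolynomial.T m * (LaurentPolynomial.T n * f) = LaurentPolynomial.T (m + n) * f
  rw [LaurentPolynomial.T_add, mul_assoc]

theorem opD_mul_opT (n : ℤ) : opD * opT n = opT n * opD + (n : ℂ) • opT n := by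
  refine Subtype.ext (LinearMap.ext fun f => ?_)
  exact euler_T_mul n f

section Twist

variable (b : ℂ) (A : Type*) [AddCommGroup A] [Module ℂ A] [Module laurentDiffOps A]
  [IsScalarTower ℂ laurentDiffOps A]

/-- The space of `A_b`. -/
def Twist (_b : ℂ) (A : Type*) : Type _ := A

instance : AddCommGroup (Twist b A) := inferInstanceAs (AddCommGroup A)

instance : Module ℂ (Twist b A) := inferInstanceAs (Module ℂ A)

/-- The operator of `d_n` on `A_b`: `v ↦ (t ^ n D + n b t ^ n) v` with `D = t d/dt`. -/
def twistAction (n : ℤ) : Module.End ℂ A :=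
  Algebra.lsmul ℂ ℂ A (opT n * opD + ((n : ℂ) * b) • opT n)

theorem twistAction_bracket (m n : ℤ) (v : A) : twistAction b A m (twistAction b A n v) -
    twistAction b A n (twistAction b A m v) = ((n : ℂ) - m) • twistAction b A (m + n) v := by
  have h (m n : ℤ) : (opT m * opD + ((m : ℂ) * b) • opT m) * (opT n * opD + ((n : ℂ) * b) • opT n) =
      opT (m + n) * opD * opD + ((n : ℂ) + m * b + n * b) • (opT (m + n) * opD) +
        ((n : ℂ) * n * b + m * n * b * b) • opT (m + n) := by
    have e1 : opT m * opD * (opT n * opD) =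
        opT (m + n) * opD * opD + (n : ℂ) • (opT (m + n) * opD) := by
      rw [show opT m * opD * (opT n * opD) = opT m * (opD * opT n) * opD by noncomm_ring,
        opD_mul_opT, mul_add, add_mul, ← mul_assoc, opT_mul, mul_smul_comm, smul_mul_assoc, opT_mul]
    have e2 : opT m * opD * opT n = opT (m + n) * opD + (n : ℂ) • opT (m + n) := by
      rw [mul_assoc, opD_mul_opT, mul_add, ← mul_assoc, opT_mul, mul_smul_comm, opT_mul]
    rw [add_mul, mul_add, mul_add, e1, mul_smul_comm, e2, smul_mul_assoc, smul_mul_smul_comm,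
      ← mul_assoc, opT_mul]
    module
  have key : (opT m * opD + ((m : ℂ) * b) • opT m) * (opT n * opD + ((n : ℂ) * b) • opT n) =
      ((n : ℂ) - m) • (opT (m + n) * opD + (((m + n : ℤ) : ℂ) * b) • opT (m + n)) +
      (opT n * opD + ((n : ℂ) * b) • opT n) * (opT m * opD + ((m : ℂ) * b) • opT m) := by
    rw [h, h, add_comm n m]
    push_cast
    module
  have gen (P Q R : laurentDiffOps) (r : ℂ) (hPQ : P * Q = r • R + Q * P) :
      P • Q • v - Q • P • v = r • R • v := by
    rw [← mul_smul, hPQ, add_smul, smul_assoc, mul_smul, add_sub_cancel_right]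
  exact gen _ _ _ _ key

/-- The representation `A_b`; here `c` acts as zero. -/
def twistRep : Vir →ₗ⁅ℂ⁆ Module.End ℂ (Twist b A) :=
  Vir.repOfOperators (W := Twist b A) (twistAction b A) (twistAction_bracket b A)

instance : LieRingModule Vir (Twist b A) := LieRingModule.compLieHom _ (twistRep b A)

instance : LieModule ℂ Vir (Twist b A) := LieModule.compLieHom _ (twistRep b A)

theorem twistAction_apply (n : ℤ) (v : A) :
    twistAction b A n v = opT n • opD • v + ((n : ℂ) * b) • opT n • v := by
  change (opT n * opD + ((n : ℂ) * b) • opT n) • v = _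
  rw [add_smul, mul_smul, smul_assoc]

theorem Twist.lie_d (n : ℤ) (v : Twist b A) : ⁅Vir.d n, v⁆ = (twistAction b A n v : Twist b A) :=
  LinearMap.congr_fun (Vir.repOfOperators_d (W := Twist b A) _ (twistAction_bracket b A) n) v

theorem Twist.lie_c (v : Twist b A) : ⁅Vir.c, v⁆ = 0 :=
  LinearMap.congr_fun (Vir.repOfOperators_c (W := Twist b A) _ (twistAction_bracket b A)) v

end Twist

/-- The subalgebra `Vir₊` of `Vir` spanned by all `d_i` with `i ≥ 0`. -/
def VirPlus : LieSubalgebra ℂ Vir :=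
  { Submodule.span ℂ (Set.range fun i : ℕ => Vir.d i) with
    lie_mem' := by
      intro x y hx hy
      change ⁅x, y⁆ ∈ Submodule.span ℂ (Set.range fun i : ℕ => Vir.d i)
      induction hx, hy using Submodule.span_induction₂ with
      | mem_mem x y hx hy =>
        obtain ⟨i, rfl⟩ := hx
        obtain ⟨j, rfl⟩ := hy
        rw [Vir.lie_d_d]
        refine Submodule.add_mem _ (Submodule.smul_mem _ _ (Submodule.subset_span ⟨i + j, by simp⟩)) ?_
        split_ifs with h
        · have : i = 0 := by omega
          subst this
          simp
        · exact Submodule.zero_mem _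
      | zero_left y hy => simp
      | zero_right x hx => simp
      | add_left x y z _ _ _ h1 h2 => rw [add_lie]; exact Submodule.add_mem _ h1 h2
      | add_right x y z _ _ _ h1 h2 => rw [lie_add]; exact Submodule.add_mem _ h1 h2
      | smul_left r x y _ _ h => rw [smul_lie]; exact Submodule.smul_mem _ _ h
      | smul_right r x y _ _ h => rw [lie_smul]; exact Submodule.smul_mem _ _ h }

/-- The element `d_i` of `Vir₊`. -/
def VirPlus.d (i : ℕ) : VirPlus := ⟨Vir.d i, Submodule.subset_span ⟨i, rfl⟩⟩

theorem VirPlus.lie_d_d (i j : ℕ) :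
    ⁅VirPlus.d i, VirPlus.d j⁆ = ((j : ℂ) - i) • VirPlus.d (i + j) := by
  refine Subtype.ext ?_
  change ⁅Vir.d i, Vir.d j⁆ = ((j : ℂ) - i) • Vir.d ((i + j : ℕ) : ℤ)
  rw [Vir.lie_d_d]
  split_ifs with h
  · have : i = 0 := by omega
    subst this
    simp
  · simp

theorem VirPlus.span_d : Submodule.span ℂ (Set.range VirPlus.d) = ⊤ := by
  refine Submodule.map_injective_of_injective (f := VirPlus.toSubmodule.subtype)
    Subtype.val_injective ?_
  rw [Submodule.map_span, ← Set.range_comp, Submodule.map_top, Submodule.range_subtype]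
  rfl

/-- The ideal of `Vir₊` spanned by all `d_i` with `i > k`. -/
def VirPlusAbove (k : ℕ) : LieIdeal ℂ VirPlus :=
  { Submodule.span ℂ (VirPlus.d '' Set.Ioi k) with
    lie_mem := by
      intro x y hy
      change ⁅x, y⁆ ∈ Submodule.span ℂ (VirPlus.d '' Set.Ioi k)
      change y ∈ Submodule.span ℂ (VirPlus.d '' Set.Ioi k) at hy
      have hx : x ∈ Submodule.span ℂ (Set.range VirPlus.d) := by
        rw [VirPlus.span_d]; trivial
      induction hx, hy using Submodule.span_induction₂ with
      | mem_mem x y hx hy =>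
        obtain ⟨i, rfl⟩ := hx
        obtain ⟨j, hj, rfl⟩ := hy
        rw [VirPlus.lie_d_d]
        refine Submodule.smul_mem _ _ (Submodule.subset_span ⟨i + j, ?_, rfl⟩)
        have : k < j := hj
        change k < i + j
        omega
      | zero_left y hy => simp
      | zero_right x hx => simp
      | add_left x y z _ _ _ h1 h2 => rw [add_lie]; exact Submodule.add_mem _ h1 h2
      | add_right x y z _ _ _ h1 h2 => rw [lie_add]; exact Submodule.add_mem _ h1 h2
      | smul_left r x y _ _ h => rw [smul_lie]; exact Submodule.smul_mem _ _ h
      | smul_right r x y _ _ h => rw [lie_smul]; exact Submodule.smul_mem _ _ h }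

/-- The Lie algebra `𝔞_k = Vir₊ / Vir₊^(k)`. -/
abbrev TruncatedVir (k : ℕ) : Type := VirPlus ⧸ VirPlusAbove k

/-- The class of `d_i` in `𝔞_k`. -/
def TruncatedVir.d (k i : ℕ) : TruncatedVir k := LieSubmodule.Quotient.mk (VirPlus.d i)

theorem TruncatedVir.lie_d_d (k i j : ℕ) : ⁅TruncatedVir.d k i, TruncatedVir.d k j⁆ =
    ((j : ℂ) - i) • TruncatedVir.d k (i + j) := by
  rw [TruncatedVir.d, TruncatedVir.d, ← LieSubmodule.Quotient.mk_bracket, VirPlus.lie_d_d]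
  rfl

theorem TruncatedVir.d_eq_zero {k i : ℕ} (h : k < i) : TruncatedVir.d k i = 0 :=
  (LieSubmodule.Quotient.mk_eq_zero' (N := VirPlusAbove k)).mpr (Submodule.subset_span ⟨i, h, rfl⟩)

section Loop

/-- The element `∑_{i = 0}^k m ^ (i + 1) / (i + 1)! d̄_i` of `𝔞_k`. -/
def truncSeries (k : ℕ) (m : ℤ) : TruncatedVir k :=
  ∑ i ∈ Finset.range (k + 1), ((m : ℂ) ^ (i + 1) / (i + 1).factorial) • TruncatedVir.d k i

theorem sum_binomial (x y : ℂ) (p : ℕ) :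
    ∑ i ∈ Finset.range (p + 1), x ^ (i + 1) / (i + 1).factorial *
      (y ^ (p - i + 1) / (p - i + 1).factorial) * (((p - i : ℕ) : ℂ) - i) =
    ((y - x) * (x + y) ^ (p + 1) - y * y ^ (p + 1) + x * x ^ (p + 1)) / (p + 1).factorial := by
  have hf (q : ℕ) : ((q.factorial : ℕ) : ℂ) ≠ 0 := by exact_mod_cast q.factorial_ne_zero
  have hbin : (x + y) ^ (p + 1) / (p + 1).factorial = ∑ i ∈ Finset.range (p + 2),
      x ^ i / i.factorial * (y ^ (p + 1 - i) / (p + 1 - i).factorial) := by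
    rw [add_pow, Finset.sum_div]
    refine Finset.sum_congr rfl fun i hi => ?_
    have hi' : i ≤ p + 1 := by have := Finset.mem_range.mp hi; omega
    rw [Nat.cast_choose ℂ hi']
    field_simp [hf]
  have hA : ∑ i ∈ Finset.range (p + 1), x ^ (i + 1) / (i + 1).factorial *
      (y ^ (p - i) / (p - i).factorial) =
      (x + y) ^ (p + 1) / (p + 1).factorial - y ^ (p + 1) / (p + 1).factorial := by
    rw [hbin, Finset.sum_range_succ' _ (p + 1)]
    simp only [Nat.add_sub_add_right]
    simp
  have hB : ∑ i ∈ Finset.range (p + 1), x ^ i / i.factorial *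
      (y ^ (p - i + 1) / (p - i + 1).factorial) =
      (x + y) ^ (p + 1) / (p + 1).factorial - x ^ (p + 1) / (p + 1).factorial := by
    rw [hbin, Finset.sum_range_succ _ (p + 1)]
    have : ∀ i ∈ Finset.range (p + 1), x ^ i / i.factorial *
      (y ^ (p - i + 1) / (p - i + 1).factorial) = x ^ i / i.factorial *
      (y ^ (p + 1 - i) / (p + 1 - i).factorial) := fun i hi => by
        rw [show p + 1 - i = p - i + 1 by have := Finset.mem_range.mp hi; omega]
    rw [Finset.sum_congr rfl this]
    simp
  have hterm : ∀ i ∈ Finset.range (p + 1), x ^ (i + 1) / (i + 1).factorial *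
      (y ^ (p - i + 1) / (p - i + 1).factorial) * (((p - i : ℕ) : ℂ) - i) =
      y * (x ^ (i + 1) / (i + 1).factorial * (y ^ (p - i) / (p - i).factorial)) -
        x * (x ^ i / i.factorial * (y ^ (p - i + 1) / (p - i + 1).factorial)) := by
    intro i _
    have h1 : ((p - i : ℕ) : ℂ) + 1 ≠ 0 := by exact_mod_cast (p - i).succ_ne_zero
    have h2 : (i : ℂ) + 1 ≠ 0 := by exact_mod_cast i.succ_ne_zero
    rw [Nat.factorial_succ, Nat.factorial_succ]
    push_cast
    field_simp [hf]
    ring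
  rw [Finset.sum_congr rfl hterm, Finset.sum_sub_distrib, ← Finset.mul_sum, ← Finset.mul_sum, hA, hB]
  ring

theorem truncSeries_bracket (k : ℕ) (m n : ℤ) : ⁅truncSeries k m, truncSeries k n⁆ =
    ((n : ℂ) - m) • truncSeries k (m + n) - (n : ℂ) • truncSeries k n
      + (m : ℂ) • truncSeries k m := by
  let F (i j : ℕ) : TruncatedVir k := ((m : ℂ) ^ (i + 1) / (i + 1).factorial *
    ((n : ℂ) ^ (j + 1) / (j + 1).factorial) * ((j : ℂ) - i)) • TruncatedVir.d k (i + j)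
  have h1 : ⁅truncSeries k m, truncSeries k n⁆ =
      ∑ i ∈ Finset.range (k + 1), ∑ j ∈ Finset.range (k + 1 - i), F i j := by
    have h2 : ⁅truncSeries k m, truncSeries k n⁆ =
        ∑ i ∈ Finset.range (k + 1), ∑ j ∈ Finset.range (k + 1), F i j := by
      rw [truncSeries, truncSeries, sum_lie_sum]
      refine Finset.sum_congr rfl fun i _ => Finset.sum_congr rfl fun j _ => ?_
      rw [smul_lie, lie_smul, TruncatedVir.lie_d_d, smul_smul, smul_smul]
    rw [h2]
    refine Finset.sum_congr rfl fun i _ => (Finset.sum_subset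
      (Finset.range_subset_range.mpr (by omega)) fun j _ hj => ?_).symm
    have : k < i + j := by
      have := Finset.mem_range.not.mp hj
      omega
    simp only [F, TruncatedVir.d_eq_zero this, smul_zero]
  rw [h1, ← Finset.sum_range_diag_flip]
  simp only [truncSeries, Finset.smul_sum, ← Finset.sum_sub_distrib, ← Finset.sum_add_distrib]
  refine Finset.sum_congr rfl fun p _ => ?_
  have h3 : ∑ i ∈ Finset.range (p + 1), F i (p - i) =
      (∑ i ∈ Finset.range (p + 1), (m : ℂ) ^ (i + 1) / (i + 1).factorial *
        ((n : ℂ) ^ (p - i + 1) / (p - i + 1).factorial) * (((p - i : ℕ) : ℂ) - i)) •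
        TruncatedVir.d k p := by
    rw [Finset.sum_smul]
    refine Finset.sum_congr rfl fun i hi => ?_
    have : i + (p - i) = p := by
      have := Finset.mem_range.mp hi
      omega
    simp only [F, this]
  rw [h3, sum_binomial, smul_smul, smul_smul, smul_smul, ← sub_smul, ← add_smul]
  congr 1
  push_cast
  ring

variable (k : ℕ) (M : Type*) [AddCommGroup M] [Module ℂ M] [LieRingModule (TruncatedVir k) M]
  [LieModule ℂ (TruncatedVir k) M] (β : ℂ[T;T⁻¹])

/-- The space `M ⊗ ℂ[t, t⁻¹]` of `N(M, β)`. -/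
def LoopModule (_k : ℕ) (M : Type*) [AddCommGroup M] [Module ℂ M] (_β : ℂ[T;T⁻¹]) : Type _ :=
  M ⊗[ℂ] ℂ[T;T⁻¹]

instance : AddCommGroup (LoopModule k M β) := inferInstanceAs (AddCommGroup (M ⊗[ℂ] ℂ[T;T⁻¹]))

instance : Module ℂ (LoopModule k M β) := inferInstanceAs (Module ℂ (M ⊗[ℂ] ℂ[T;T⁻¹]))

/-- The operator of `d_m` on `M ⊗ ℂ[t, t⁻¹]`:
`v ⊗ t ^ n ↦ (n + ∑_{i = 0}^k m ^ (i + 1) / (i + 1)! d̄_i) v ⊗ t ^ (n + m) + v ⊗ β t ^ (m + n)`. -/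
def loopAction (m : ℤ) : Module.End ℂ (M ⊗[ℂ] ℂ[T;T⁻¹]) :=
  TensorProduct.map LinearMap.id
      (LinearMap.mulLeft ℂ (LaurentPolynomial.T m) ∘ₗ (euler + LinearMap.mulLeft ℂ β)) +
    TensorProduct.map (LieModule.toEnd ℂ (TruncatedVir k) M (truncSeries k m))
      (LinearMap.mulLeft ℂ (LaurentPolynomial.T m))

theorem loopAction_tmul (m : ℤ) (v : M) (f : ℂ[T;T⁻¹]) : loopAction k M β m (v ⊗ₜ f) =
    v ⊗ₜ (LaurentPolynomial.T m * (euler f + β * f)) +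
      ⁅truncSeries k m, v⁆ ⊗ₜ (LaurentPolynomial.T m * f) := rfl

theorem loopAction_bracket (m n : ℤ) (w : M ⊗[ℂ] ℂ[T;T⁻¹]) :
    loopAction k M β m (loopAction k M β n w) - loopAction k M β n (loopAction k M β m w) =
      ((n : ℂ) - m) • loopAction k M β (m + n) w := by
  induction w using TensorProduct.induction_on with
  | zero => simp
  | add x y hx hy => simp only [map_add, smul_add, ← hx, ← hy]; abel
  | tmul v f =>
    have hX : ⁅truncSeries k m, ⁅truncSeries k n, v⁆⁆ = ⁅truncSeries k n, ⁅truncSeries k m, v⁆⁆ +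
        (((n : ℂ) - m) • ⁅truncSeries k (m + n), v⁆ - (n : ℂ) • ⁅truncSeries k n, v⁆ +
          (m : ℂ) • ⁅truncSeries k m, v⁆) := by
      rw [leibniz_lie, truncSeries_bracket, add_lie, sub_lie, smul_lie, smul_lie, smul_lie,
        add_comm]
    have hT (a b : ℤ) (g : ℂ[T;T⁻¹]) : LaurentPolynomial.T a * (LaurentPolynomial.T b * g) =
        LaurentPolynomial.T (a + b) * g := by rw [LaurentPolynomial.T_add, mul_assoc]
    have hβ (a b : ℤ) (g : ℂ[T;T⁻¹]) : LaurentPolynomial.T a * (β * (LaurentPolynomial.T b * g)) =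
        LaurentPolynomial.T (a + b) * (β * g) := by rw [LaurentPolynomial.T_add]; ring
    simp only [loopAction_tmul, map_add, euler_T_mul, mul_add, hT, hβ, hX, TensorProduct.tmul_add,
      TensorProduct.add_tmul, TensorProduct.sub_tmul, ← TensorProduct.smul_tmul',
      TensorProduct.tmul_smul, mul_smul_comm, add_comm n m]
    module

/-- The representation `N(M, β)`; here `c` acts as zero. -/
def loopRep : Vir →ₗ⁅ℂ⁆ Module.End ℂ (LoopModule k M β) :=
  Vir.repOfOperators (W := LoopModule k M β) (loopAction k M β) (loopAction_bracket k M β)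

instance : LieRingModule Vir (LoopModule k M β) := LieRingModule.compLieHom _ (loopRep k M β)

instance : LieModule ℂ Vir (LoopModule k M β) := LieModule.compLieHom _ (loopRep k M β)

theorem LoopModule.lie_d (m : ℤ) (w : LoopModule k M β) :
    ⁅Vir.d m, w⁆ = (loopAction k M β m w : LoopModule k M β) :=
  LinearMap.congr_fun (Vir.repOfOperators_d (W := LoopModule k M β) _ (loopAction_bracket k M β) m) w

theorem LoopModule.lie_c (w : LoopModule k M β) : ⁅Vir.c, w⁆ = 0 :=
  LinearMap.congr_fun (Vir.repOfOperators_c (W := LoopModule k M β) _ (loopAction_bracket k M β)) w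

end Loop

section Induced

variable (N : Type*) [AddCommGroup N] [Module ℂ N] [LieRingModule VirPlus N]
  [LieModule ℂ VirPlus N]

/-- The inclusion `U(Vir₊) → U(Vir)`. -/
def envelopingIncl : UniversalEnvelopingAlgebra ℂ VirPlus →ₐ[ℂ] UniversalEnvelopingAlgebra ℂ Vir :=
  UniversalEnvelopingAlgebra.lift ℂ ((UniversalEnvelopingAlgebra.ι ℂ).comp VirPlus.incl)

/-- The action of `U(Vir₊)` on a `Vir₊`-module `N`. -/
def envelopingAction : UniversalEnvelopingAlgebra ℂ VirPlus →ₐ[ℂ] Module.End ℂ N :=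
  UniversalEnvelopingAlgebra.lift ℂ (LieModule.toEnd ℂ VirPlus N)

/-- The relations `u a ⊗ v = u ⊗ a v` with `a ∈ U(Vir₊)` that cut out
`U(Vir) ⊗_{U(Vir₊)} N` from `U(Vir) ⊗_ℂ N`. -/
def inducedRel : Submodule ℂ (UniversalEnvelopingAlgebra ℂ Vir ⊗[ℂ] N) :=
  Submodule.span ℂ {z | ∃ (u : UniversalEnvelopingAlgebra ℂ Vir)
    (a : UniversalEnvelopingAlgebra ℂ VirPlus) (v : N),
    z = (u * envelopingIncl a) ⊗ₜ[ℂ] v - u ⊗ₜ[ℂ] (envelopingAction N a v)}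

/-- `Ind(N) = U(Vir) ⊗_{U(Vir₊)} N`. -/
def Induced : Type _ := (UniversalEnvelopingAlgebra ℂ Vir ⊗[ℂ] N) ⧸ inducedRel N

instance : AddCommGroup (Induced N) :=
  inferInstanceAs (AddCommGroup ((UniversalEnvelopingAlgebra ℂ Vir ⊗[ℂ] N) ⧸ inducedRel N))

instance : Module ℂ (Induced N) :=
  inferInstanceAs (Module ℂ ((UniversalEnvelopingAlgebra ℂ Vir ⊗[ℂ] N) ⧸ inducedRel N))

theorem inducedRel_le (u : UniversalEnvelopingAlgebra ℂ Vir) :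
    inducedRel N ≤ (inducedRel N).comap ((LinearMap.mulLeft ℂ u).rTensor N) := by
  refine Submodule.span_le.mpr ?_
  rintro _ ⟨w, a, v, rfl⟩
  refine Submodule.subset_span ⟨u * w, a, v, ?_⟩
  simp [mul_assoc]

/-- Left multiplication by elements of `U(Vir)` on `Ind(N)`. -/
def inducedAction (u : UniversalEnvelopingAlgebra ℂ Vir) : Module.End ℂ (Induced N) :=
  (inducedRel N).mapQ (inducedRel N) ((LinearMap.mulLeft ℂ u).rTensor N) (inducedRel_le N u)

/-- `Ind(N)` as a representation of `Vir`. -/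
def inducedRep : Vir →ₗ⁅ℂ⁆ Module.End ℂ (Induced N) where
  toFun x := inducedAction N (UniversalEnvelopingAlgebra.ι ℂ x)
  map_add' x y := by
    refine Submodule.linearMap_qext _ (TensorProduct.ext' fun u v => ?_)
    change (inducedRel N).mkQ _ = (inducedRel N).mkQ _ + (inducedRel N).mkQ _
    rw [← map_add]
    congr 1
    simp only [LinearMap.rTensor_tmul, LinearMap.mulLeft_apply, map_add, add_mul,
      TensorProduct.add_tmul]
  map_smul' r x := by
    refine Submodule.linearMap_qext _ (TensorProduct.ext' fun u v => ?_)
    change (inducedRel N).mkQ _ = r • (inducedRel N).mkQ _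
    rw [← map_smul]
    congr 1
    simp only [LinearMap.rTensor_tmul, LinearMap.mulLeft_apply, map_smul, smul_mul_assoc,
      TensorProduct.smul_tmul']
  map_lie' {x y} := by
    refine Submodule.linearMap_qext _ (TensorProduct.ext' fun u v => ?_)
    change (inducedRel N).mkQ _ = (inducedRel N).mkQ _ - (inducedRel N).mkQ _
    rw [← map_sub]
    congr 1
    simp only [LinearMap.rTensor_tmul, LinearMap.mulLeft_apply, LieHom.map_lie, Ring.lie_def,
      sub_mul, TensorProduct.sub_tmul, mul_assoc]

instance : LieRingModule Vir (Induced N) := LieRingModule.compLieHom _ (inducedRep N)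

instance : LieModule ℂ Vir (Induced N) := LieModule.compLieHom _ (inducedRep N)

/-- The projection `U(Vir) ⊗_ℂ N → Ind(N)`. -/
def Induced.mk : UniversalEnvelopingAlgebra ℂ Vir ⊗[ℂ] N →ₗ[ℂ] Induced N := (inducedRel N).mkQ

theorem Induced.lie_mk (x : Vir) (u : UniversalEnvelopingAlgebra ℂ Vir) (v : N) :
    ⁅x, Induced.mk N (u ⊗ₜ[ℂ] v)⁆ =
      Induced.mk N ((UniversalEnvelopingAlgebra.ι ℂ x * u) ⊗ₜ[ℂ] v) := rfl

/-- The submodule `(c - θ) Ind(N)`. -/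
def centralSubmodule (θ : ℂ) : LieSubmodule ℂ Vir (Induced N) :=
  { LinearMap.range (LieModule.toEnd ℂ Vir (Induced N) Vir.c - θ • LinearMap.id) with
    lie_mem := by
      rintro x _ ⟨w, rfl⟩
      refine ⟨⁅x, w⁆, ?_⟩
      change ⁅Vir.c, ⁅x, w⁆⁆ - θ • ⁅x, w⁆ = ⁅x, ⁅Vir.c, w⁆ - θ • w⁆
      rw [lie_sub, lie_smul, leibniz_lie, Vir.c_lie, zero_lie, zero_add] }

/-- `Ind_θ(N) = Ind(N) / (c - θ) Ind(N)`. -/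
abbrev InducedTheta (θ : ℂ) : Type _ := Induced N ⧸ centralSubmodule N θ

end Induced

/-- Every vector lies in a finite-dimensional subspace that is stable under `f`. -/
def IsLocallyFiniteEnd {W : Type*} [AddCommGroup W] [Module ℂ W] (f : Module.End ℂ W) : Prop :=
  ∀ w : W, ∃ p : Submodule ℂ W, FiniteDimensional ℂ p ∧ w ∈ p ∧ ∀ u ∈ p, f u ∈ p

end

/-! For a vector `w`, consider `d_x d_y w` as a function of `(x, y)` and take iterated differences
along the antidiagonals `x + y = s`. On each of these a term `x^a y^b c(x + y)` is a polynomial of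
degree `a + b`, so `a + b` differences leave `(-1)^b (a + b)! c` and one more leaves zero. This
separates the modules. In `A_b` all terms have degree at most 2, so three differences kill
everything. In `N(M, γ)` the unique term of top degree is `x^(k+1) y^(k+1)`, whose coefficient is
`d̄_k²` tensored with multiplication by `t^(x+y)`, up to a nonzero scalar. Hence `2k + 2`
differences give an injective operator that depends on `x + y` only, and `2k + 3` differences give
zero. If `T` has at least two factors, no such relation of odd order holds: some matrix coefficient
of `d_x d_y` is `λ^x u(x) μ^y + μ^x λ^y u(y)` with `u` of arbitrarily high degree
(`not_antiDiff_pow_lieLie_eq_zero`). For one factor, `Ω(μ, β)` has degree 2, which contradicts the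
injectivity in `N(M, γ)`. In `Ω(λ, α, h)` four differences at `f(t)` give `24 λ^(x+y+4) B(B f)`,
where `B` is the coefficient of `m²` in the action. This is nonzero for some `f`, which excludes
`A_b`; its geometric growth in `x` is incompatible with the factor `t^(x+y)` in `N(M, γ)`. Finally,
every vector of `Ind_θ(N)` is killed by `d_i` for all large `i`, while `T` has a vector that no
`d_x` kills. The factor `V` contributes a nonzero `v` killed by all `d_i` with `i` large
(`exists_mem_eventuallyKilled`), so `a ↦ a ⊗ v` commutes with these `d_i`. The arguments above need
only large `x` and `y`, hence they are stated for `EventuallyEmbeds` and cover `T ⊗ V` as well. The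
exception is `Ω(μ, β) ⊗ V` against `A_b` with `dim V = ∞`. There negative indices enter: the
vanishing third difference gives a linear recurrence for `y ↦ d_y v`, which is zero for large `y`
and hence for all `y`, so `V` is trivial (`finiteDimensional_of_omegaPair_tensor_hom`). -/

noncomputable section

attribute [local instance] LieRing.ofAssociativeRing

/-! ### Differences along antidiagonals -/

section AntiDiff

variable (W : Type*) [AddCommGroup W] [Module ℂ W]

/-- The difference operator `G ↦ G (x + 1) y - G x (y + 1)` along antidiagonals. -/
def antiDiff : Module.End ℂ (ℤ → ℤ → W) where
  toFun G x y := G (x + 1) y - G x (y + 1)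
  map_add' G H := by funext x y; simp only [Pi.add_apply]; abel
  map_smul' r G := by funext x y; simp only [Pi.smul_apply, RingHom.id_apply, smul_sub]

variable {W}

theorem antiDiff_apply (G : ℤ → ℤ → W) (x y : ℤ) :
    antiDiff W G x y = G (x + 1) y - G x (y + 1) := rfl

theorem antiDiff_pow_succ (r : ℕ) (G : ℤ → ℤ → W) :
    (antiDiff W ^ (r + 1)) G = (antiDiff W ^ r) (antiDiff W G) := by
  rw [pow_succ]; rfl

theorem antiDiff_pow_eq_zero_of_le {r s : ℕ} (hrs : r ≤ s) {G : ℤ → ℤ → W}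
    (hG : (antiDiff W ^ r) G = 0) : (antiDiff W ^ s) G = 0 := by
  rw [← Nat.sub_add_cancel hrs, pow_add, Module.End.mul_apply, hG, map_zero]

/-- The difference at a point involves only points to its right and above it, so quadrants are
respected. This is why commuting with `d_x` for large `x` suffices later. -/
theorem antiDiff_pow_congr {p q : ℤ} (r : ℕ) {G H : ℤ → ℤ → W}
    (h : ∀ x y, p ≤ x → q ≤ y → G x y = H x y) :
    ∀ x y, p ≤ x → q ≤ y → (antiDiff W ^ r) G x y = (antiDiff W ^ r) H x y := by
  induction r generalizing G H with
  | zero => exact h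
  | succ r ih =>
    simp only [antiDiff_pow_succ]
    refine ih fun x y hx hy => ?_
    rw [antiDiff_apply, antiDiff_apply, h _ _ (by omega) hy, h _ _ hx (by omega)]

theorem antiDiff_pow_map {W' : Type*} [AddCommGroup W'] [Module ℂ W'] (f : W →ₗ[ℂ] W') (r : ℕ)
    (G : ℤ → ℤ → W) (x y : ℤ) :
    (antiDiff W' ^ r) (fun (x y : ℤ) => f (G x y)) x y = f ((antiDiff W ^ r) G x y) := by
  induction r generalizing G with
  | zero => rfl
  | succ r ih =>
    rw [antiDiff_pow_succ, antiDiff_pow_succ, ← ih]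
    have : antiDiff W' (fun (x y : ℤ) => f (G x y)) = fun (x y : ℤ) => f (antiDiff W G x y) := by
      funext x y
      simp only [antiDiff_apply, map_sub]
    rw [this]

theorem antiDiff_pow_shift_left (r : ℕ) (G : ℤ → ℤ → W) (x y : ℤ) :
    (antiDiff W ^ r) (fun (x y : ℤ) => G (x + 1) y) x y = (antiDiff W ^ r) G (x + 1) y := by
  induction r generalizing G with
  | zero => rfl
  | succ r ih => rw [antiDiff_pow_succ, antiDiff_pow_succ, ← ih]; rfl

theorem antiDiff_pow_shift_right (r : ℕ) (G : ℤ → ℤ → W) (x y : ℤ) :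
    (antiDiff W ^ r) (fun (x y : ℤ) => G x (y + 1)) x y = (antiDiff W ^ r) G x (y + 1) := by
  induction r generalizing G with
  | zero => rfl
  | succ r ih => rw [antiDiff_pow_succ, antiDiff_pow_succ, ← ih]; rfl

/-- Leibniz rule: the coordinate `x` has difference 1 along an antidiagonal and `y` has difference
-1, which accounts for the sign in the companion lemma. -/
theorem antiDiff_pow_smul_left (r : ℕ) (G : ℤ → ℤ → W) (x y : ℤ) :
    (antiDiff W ^ (r + 1)) (fun (x y : ℤ) => (x : ℂ) • G x y) x y =
      (x : ℂ) • (antiDiff W ^ (r + 1)) G x y +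
        ((r : ℂ) + 1) • (antiDiff W ^ r) G (x + 1) y := by
  have h1 (G : ℤ → ℤ → W) : antiDiff W (fun (x y : ℤ) => (x : ℂ) • G x y) =
      (fun (x y : ℤ) => (x : ℂ) • antiDiff W G x y) + fun (x y : ℤ) => G (x + 1) y := by
    funext x y
    simp only [antiDiff_apply, Pi.add_apply]
    push_cast
    module
  induction r generalizing G x y with
  | zero => simp [h1]
  | succ r ih =>
    rw [antiDiff_pow_succ, h1, map_add, Pi.add_apply, Pi.add_apply, ih, antiDiff_pow_shift_left,
      ← antiDiff_pow_succ, ← antiDiff_pow_succ]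
    push_cast
    module

theorem antiDiff_pow_smul_right (r : ℕ) (G : ℤ → ℤ → W) (x y : ℤ) :
    (antiDiff W ^ (r + 1)) (fun (x y : ℤ) => (y : ℂ) • G x y) x y =
      (y : ℂ) • (antiDiff W ^ (r + 1)) G x y -
        ((r : ℂ) + 1) • (antiDiff W ^ r) G x (y + 1) := by
  have h1 (G : ℤ → ℤ → W) : antiDiff W (fun (x y : ℤ) => (y : ℂ) • G x y) =
      (fun (x y : ℤ) => (y : ℂ) • antiDiff W G x y) - fun (x y : ℤ) => G x (y + 1) := by
    funext x y
    simp only [antiDiff_apply, Pi.sub_apply]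
    push_cast
    module
  induction r generalizing G x y with
  | zero => simp [h1]
  | succ r ih =>
    rw [antiDiff_pow_succ, h1, map_sub, Pi.sub_apply, Pi.sub_apply, ih, antiDiff_pow_shift_right,
      ← antiDiff_pow_succ, ← antiDiff_pow_succ]
    push_cast
    module

theorem antiDiff_diagonal (c : ℤ → W) : antiDiff W (fun (x y : ℤ) => c (x + y)) = 0 := by
  funext x y
  rw [antiDiff_apply, Pi.zero_apply, Pi.zero_apply, sub_eq_zero]
  congr 1
  ring

/-- `x ^ a y ^ b c(x + y)` -/
def antiMonomial (a b : ℕ) (c : ℤ → W) : ℤ → ℤ → W :=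
  fun (x y : ℤ) => ((x : ℂ) ^ a * (y : ℂ) ^ b) • c (x + y)

/-- On `x + y = s` the monomial is a polynomial in `x` with leading term `(-1)^b x^(a+b)`, whose
difference of order `a + b` is its leading coefficient times a factorial. Each difference at sum `s`
reads values at sum `s + 1`, hence the shift in the argument of `c`. -/
theorem antiDiff_pow_antiMonomial (a b : ℕ) (c : ℤ → W) :
    (antiDiff W ^ (a + b)) (antiMonomial a b c) =
      fun (x y : ℤ) => ((-1) ^ b * ((a + b).factorial : ℂ)) • c (x + y + (a + b : ℕ)) := by
  have hzero (r : ℕ) {G : ℤ → ℤ → W} {k : ℂ} {s : ℤ}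
      (h : (antiDiff W ^ r) G = fun (x y : ℤ) => k • c (x + y + s)) : (antiDiff W ^ (r + 1)) G = 0 := by
    rw [pow_succ', Module.End.mul_apply, h, antiDiff_diagonal fun z => k • c (z + s)]
  induction b with
  | zero =>
    induction a with
    | zero => funext x y; simp [antiMonomial]
    | succ a ih =>
      have h1 : antiMonomial (a + 1) 0 c = fun (x y : ℤ) => (x : ℂ) • antiMonomial a 0 c x y := by
        funext x y
        simp only [antiMonomial, smul_smul]
        ring_nf
      funext x y
      rw [add_zero] at ih
      rw [h1, add_zero, antiDiff_pow_smul_left, ih, hzero _ ih,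
        Pi.zero_apply, Pi.zero_apply, smul_zero, zero_add, smul_smul, Nat.factorial_succ,
        show x + 1 + y + (a : ℤ) = x + y + ((a + 1 : ℕ) : ℤ) by push_cast; ring]
      congr 1
      push_cast
      ring
  | succ b ih =>
    have h1 : antiMonomial a (b + 1) c = fun (x y : ℤ) => (y : ℂ) • antiMonomial a b c x y := by
      funext x y
      simp only [antiMonomial, smul_smul]
      ring_nf
    funext x y
    rw [h1, ← add_assoc, antiDiff_pow_smul_right, ih, hzero _ ih,
      Pi.zero_apply, Pi.zero_apply, smul_zero, zero_sub, smul_smul, Nat.factorial_succ,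
      show x + (y + 1) + ((a + b : ℕ) : ℤ) = x + y + ((a + b + 1 : ℕ) : ℤ) by push_cast; ring,
      ← neg_smul]
    congr 1
    push_cast
    ring

theorem antiDiff_pow_antiMonomial_eq_zero {a b r : ℕ} (h : a + b < r) (c : ℤ → W) :
    (antiDiff W ^ r) (antiMonomial a b c) = 0 := by
  refine antiDiff_pow_eq_zero_of_le h ?_
  rw [pow_succ', Module.End.mul_apply, antiDiff_pow_antiMonomial]
  exact antiDiff_diagonal fun z => ((-1) ^ b * ((a + b).factorial : ℂ)) • c (z + (a + b : ℕ))

end AntiDiff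

/-! ### Differences of exponential polynomials -/

section Exponential

open Polynomial

/-- `f ↦ f(x + 1) - μ f(x)` -/
def shiftSub (μ : ℂ) (f : ℤ → ℂ) : ℤ → ℂ := fun x => f (x + 1) - μ * f x

theorem antiDiff_pow_symm_mul_zpow (μ : ℂˣ) (r : ℕ) (f : ℤ → ℂ) (x y : ℤ) :
    (antiDiff ℂ ^ r) (fun (x y : ℤ) => f x * ((μ ^ y : ℂˣ) : ℂ) + ((μ ^ x : ℂˣ) : ℂ) * f y) x y =
      (shiftSub μ)^[r] f x * ((μ ^ y : ℂˣ) : ℂ) +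
        (-1) ^ r * (((μ ^ x : ℂˣ) : ℂ) * (shiftSub μ)^[r] f y) := by
  have h1 (e : ℂ) (f : ℤ → ℂ) :
      antiDiff ℂ (fun (x y : ℤ) => f x * ((μ ^ y : ℂˣ) : ℂ) + e * (((μ ^ x : ℂˣ) : ℂ) * f y)) =
      fun (x y : ℤ) => shiftSub μ f x * ((μ ^ y : ℂˣ) : ℂ) +
        (-e) * (((μ ^ x : ℂˣ) : ℂ) * shiftSub μ f y) := by
    funext x y
    simp only [antiDiff_apply, shiftSub, zpow_add_one, Units.val_mul]
    ring
  have h2 (e : ℂ) : (antiDiff ℂ ^ r)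
      (fun (x y : ℤ) => f x * ((μ ^ y : ℂˣ) : ℂ) + e * (((μ ^ x : ℂˣ) : ℂ) * f y)) x y =
      (shiftSub μ)^[r] f x * ((μ ^ y : ℂˣ) : ℂ) +
        (-1) ^ r * e * (((μ ^ x : ℂˣ) : ℂ) * (shiftSub μ)^[r] f y) := by
    induction r generalizing f e with
    | zero => simp
    | succ r ih => rw [antiDiff_pow_succ, h1, ih, Function.iterate_succ_apply]; ring
  simpa using h2 1

/-- `u ↦ λ u(X + 1) - μ u` -/
def polyShiftSub (l μ : ℂ) (u : ℂ[X]) : ℂ[X] := C l * u.comp (X + 1) - C μ * u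

theorem shiftSub_iterate_zpow_mul (l μ : ℂˣ) (r : ℕ) (u : ℂ[X]) :
    (shiftSub μ)^[r] (fun (x : ℤ) => ((l ^ x : ℂˣ) : ℂ) * u.eval (x : ℂ)) =
      fun (x : ℤ) => ((l ^ x : ℂˣ) : ℂ) * ((polyShiftSub l μ)^[r] u).eval (x : ℂ) := by
  induction r generalizing u with
  | zero => rfl
  | succ r ih =>
    rw [Function.iterate_succ_apply, Function.iterate_succ_apply, ← ih]
    congr 1
    funext x
    simp only [shiftSub, polyShiftSub, zpow_add_one, Units.val_mul, eval_sub, eval_mul, eval_C,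
      eval_comp, eval_add, eval_X, eval_one]
    push_cast
    ring

/-- For `l ≠ μ` the leading coefficient is multiplied by `l - μ`, so `u = 0`; for `l = μ` the
polynomial is periodic, hence constant. -/
theorem derivative_eq_zero_of_polyShiftSub {l μ : ℂ} (hl : l ≠ 0) {u : ℂ[X]}
    (h : polyShiftSub l μ u = 0) : derivative u = 0 := by
  rw [polyShiftSub, sub_eq_zero] at h
  by_cases hlm : l = μ
  · subst hlm
    have h1 : u.comp (X + 1) = u := mul_left_cancel₀ (C_ne_zero.mpr hl) h
    have h2 (n : ℕ) : u.eval (n : ℂ) = u.eval 0 := by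
      induction n with
      | zero => simp
      | succ n ih =>
        rw [← ih]
        conv_rhs => rw [← h1]
        simp [eval_comp]
    have : u = C (u.eval 0) := by
      refine eq_of_infinite_eval_eq _ _ (Set.infinite_of_injective_forall_mem
        (f := fun n : ℕ => (n : ℂ)) Nat.cast_injective fun n => ?_)
      simp [h2]
    rw [this, derivative_C]
  · have h1 := congrArg leadingCoeff h
    rw [leadingCoeff_mul, leadingCoeff_mul, leadingCoeff_comp, leadingCoeff_C, leadingCoeff_C,
      show (X + 1 : ℂ[X]) = X + C 1 by simp, leadingCoeff_X_add_C, one_pow, mul_one] at h1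
    · have : u = 0 := by
        by_contra hu
        exact hlm (mul_right_cancel₀ (leadingCoeff_ne_zero.mpr hu) h1)
      rw [this, derivative_zero]
    · rw [show (X + 1 : ℂ[X]) = X + C 1 by simp, natDegree_X_add_C]
      exact one_ne_zero

/-- The twisted shift commutes with differentiation, so its iterates can be traded for derivatives
one at a time. -/
theorem iterate_derivative_eq_zero_of_polyShiftSub {l μ : ℂ} (hl : l ≠ 0) (r : ℕ) {u : ℂ[X]}
    (h : (polyShiftSub l μ)^[r] u = 0) : derivative^[r] u = 0 := by
  have hc : Function.Commute derivative (polyShiftSub l μ) := fun v => by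
    simp [polyShiftSub, derivative_comp]
  induction r generalizing u with
  | zero => exact h
  | succ r ih =>
    rw [Function.iterate_succ_apply'] at h
    have h1 := derivative_eq_zero_of_polyShiftSub hl h
    rw [(hc.iterate_right r).eq] at h1
    exact ih h1

theorem natDegree_lt_of_antiDiff_pow_eq_zero (l μ : ℂˣ) {r : ℕ} (hr : Odd r) (u : ℂ[X])
    (hu : u ≠ 0) (R : ℤ) (h : ∀ x y, R ≤ x → R ≤ y → (antiDiff ℂ ^ r) (fun x y =>
      ((l ^ x : ℂˣ) : ℂ) * u.eval (x : ℂ) * ((μ ^ y : ℂˣ) : ℂ) +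
        ((μ ^ x : ℂˣ) : ℂ) * (((l ^ y : ℂˣ) : ℂ) * u.eval (y : ℂ))) x y = 0) :
    u.natDegree < r + 1 := by
  by_contra! hdeg
  have h1 (x : ℤ) (hx : R ≤ x) :
      (shiftSub μ)^[r + 1] (fun (x : ℤ) => ((l ^ x : ℂˣ) : ℂ) * u.eval (x : ℂ)) x = 0 := by
    -- For odd `r` the two summands carry opposite signs, so at `(x + 1, x)` they combine to `μ^x`
    -- times one further `shiftSub μ` of the `r`-th iterate.
    have := h (x + 1) x (by omega) hx
    rw [antiDiff_pow_symm_mul_zpow μ r (fun (x : ℤ) => ((l ^ x : ℂˣ) : ℂ) * u.eval (x : ℂ)),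
      hr.neg_one_pow, zpow_add_one, Units.val_mul] at this
    rw [Function.iterate_succ_apply', shiftSub]
    refine mul_right_cancel₀ (μ ^ x).ne_zero ?_
    rw [zero_mul, ← this]
    ring
  have h2 : (polyShiftSub l μ)^[r + 1] u = 0 := by
    refine eq_zero_of_infinite_isRoot _ (Set.infinite_of_injective_forall_mem
      (f := fun n : ℕ => ((R + n : ℤ) : ℂ)) (fun a b hab => ?_) fun n => ?_)
    · simpa using hab
    · have := h1 (R + n) (by omega)
      rw [shiftSub_iterate_zpow_mul] at this
      exact (mul_eq_zero.mp this).resolve_left (l ^ (R + n : ℤ)).ne_zero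
  have h3 := iterate_derivative_eq_zero_of_polyShiftSub l.ne_zero (r + 1) h2
  have h4 := congrArg (fun p => coeff p (u.natDegree - (r + 1))) h3
  simp only [coeff_iterate_derivative, Nat.sub_add_cancel hdeg, coeff_zero, nsmul_eq_mul,
    mul_eq_zero, Nat.cast_eq_zero, Nat.descFactorial_eq_zero_iff_lt, coeff_natDegree,
    leadingCoeff_eq_zero] at h4
  exact h4.elim (fun h => by omega) hu

end Exponential

/-! ### Matrix coefficients of a single factor -/

section OmegaLike

open Polynomial

variable (S : Type*) [AddCommGroup S] [Module ℂ S] [LieRingModule Vir S] [LieModule ℂ Vir S]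

/-- The features that `Ω(l, α, h)` and `Ω(l, β)` share: a vector `e` and functionals `ε`, `χ` with
`ε e = 1`, `χ e = 0`, `χ (d_x e) = l ^ x`, and vectors on which `d_x` acts, up to `l ^ x`, by
polynomials in `x` of arbitrarily high degree. -/
structure OmegaLike (l : ℂˣ) (e : S) (ε χ : S →ₗ[ℂ] ℂ) : Prop where
  ε_self : ε e = 1
  χ_self : χ e = 0
  χ_lie : ∀ x : ℤ, χ ⁅Vir.d x, e⁆ = ((l ^ x : ℂˣ) : ℂ)
  exists_polynomial : ∀ N : ℕ, ∃ (e' : S) (ψ : S →ₗ[ℂ] ℂ) (u : ℂ[X]), N ≤ u.natDegree ∧ u ≠ 0 ∧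
    ψ e' = 0 ∧ ∀ x : ℤ, ψ ⁅Vir.d x, e'⁆ = ((l ^ x : ℂˣ) : ℂ) * u.eval (x : ℂ)

theorem exists_omegaLike_omegaPair (μ : ℂˣ) {β : ℂ} (hβ : β ≠ 0) :
    ∃ e ε χ, OmegaLike (OmegaPair μ β) μ e ε χ := by
  -- Since `d_x 1 = μ^x (∂ - βx)`, the coefficient of `∂` serves as `χ`.
  refine ⟨(1 : ℂ[X]), lcoeff ℂ 0, lcoeff ℂ 1, ?_, ?_, fun x => ?_, fun N => ?_⟩
  · change (1 : ℂ[X]).coeff 0 = 1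
    simp
  · change (1 : ℂ[X]).coeff 1 = 0
    simp [coeff_one]
  · refine (congrArg (fun p : ℂ[X] => p.coeff 1) (OmegaPair.lie_d μ β x (1 : ℂ[X]))).trans ?_
    rw [omegaPairAction_apply]
    simp [-map_mul]
  -- The constant term of `(∂ - x)^(N+1) (∂ - βx)` is `(-1)^N β x^(N+2)`; this is where `β ≠ 0`
  -- matters.
  · refine ⟨(X ^ (N + 1) : ℂ[X]), lcoeff ℂ 0, C ((-1) ^ N * β) * X ^ (N + 2), ?_, ?_, ?_,
      fun x => ?_⟩
    · rw [natDegree_C_mul_X_pow _ _ (by simp [hβ])]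
      omega
    · simp [hβ]
    · change (X ^ (N + 1) : ℂ[X]).coeff 0 = 0
      simp
    · refine (congrArg (fun p : ℂ[X] => p.coeff 0)
        (OmegaPair.lie_d μ β x (X ^ (N + 1) : ℂ[X]))).trans ?_
      rw [omegaPairAction_X_pow, coeff_smul, mul_coeff_zero, coeff_zero_eq_eval_zero,
        coeff_zero_eq_eval_zero]
      simp only [eval_pow, eval_sub, eval_X, eval_C, eval_mul, smul_eq_mul, zero_sub]
      rw [neg_pow]
      ring

theorem exists_omegaLike_omegaTriple (l : ℂˣ) {α : ℂ} (hα : α ≠ 0) (h : ℂ[X]) :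
    ∃ e ε χ, OmegaLike (OmegaTriple l α h) l e ε χ := by
  have hact (x : ℤ) (i : ℕ) (f : ℂ[X]) := omegaTripleAction_C_mul_X_pow l α h x i f
  refine ⟨(1 : ℂ[X][X]), lcoeff ℂ 0 ∘ₗ (lcoeff ℂ[X] 0).restrictScalars ℂ,
    lcoeff ℂ 0 ∘ₗ (lcoeff ℂ[X] 1).restrictScalars ℂ, ?_, ?_, fun x => ?_, fun N => ?_⟩
  · change ((1 : ℂ[X][X]).coeff 0).coeff 0 = 1
    simp
  · change ((1 : ℂ[X][X]).coeff 1).coeff 0 = 0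
    simp [coeff_one]
  · refine (congrArg (fun p : ℂ[X][X] => (p.coeff 1).coeff 0)
      (OmegaTriple.lie_d l α h x (1 : ℂ[X][X]))).trans ?_
    rw [show (1 : ℂ[X][X]) = C 1 * X ^ 0 by simp, hact]
    simp
  -- For `f = t` the terms with `h` vanish at `t = 0`, and only `-x (t - xα) f'` survives there,
  -- with value `x² α`. So the coefficient has a known degree for every `h`.
  · refine ⟨(C X * X ^ (N + 1) : ℂ[X][X]), lcoeff ℂ 0 ∘ₗ (lcoeff ℂ[X] 0).restrictScalars ℂ,
      C ((-1) ^ (N + 1) * α) * X ^ (N + 3), ?_, ?_, ?_, fun x => ?_⟩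
    · rw [natDegree_C_mul_X_pow _ _ (by simp [hα])]
      omega
    · simp [hα]
    · change ((C X * X ^ (N + 1) : ℂ[X][X]).coeff 0).coeff 0 = 0
      simp
    · refine (congrArg (fun p : ℂ[X][X] => (p.coeff 0).coeff 0)
        (OmegaTriple.lie_d l α h x (C X * X ^ (N + 1) : ℂ[X][X]))).trans ?_
      rw [hact, coeff_smul, coeff_smul, mul_coeff_zero, mul_coeff_zero]
      have h1 : (((X : ℂ[X][X]) - C (C (x : ℂ))) ^ (N + 1)).coeff 0 = C ((-(x : ℂ)) ^ (N + 1)) := by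
        rw [coeff_zero_eq_eval_zero]
        simp
      have h2 : (X * C X + C (omegaTripleCoeff α h x X) : ℂ[X][X]).coeff 0 =
          omegaTripleCoeff α h x X := by simp
      have h3 : (omegaTripleCoeff α h x X).coeff 0 = (x : ℂ) ^ 2 * α := by
        simp [omegaTripleCoeff, mul_coeff_zero]
        ring
      rw [h1, h2, h3, coeff_C_zero]
      simp only [eval_pow, eval_X, eval_C, eval_mul, smul_eq_mul]
      rw [neg_pow]
      ring

end OmegaLike

/-! ### Functionals and embeddings for tensor products -/

section FactorEmb

variable {ι : Type*} [DecidableEq ι] {S : ι → Type*} [∀ i, AddCommGroup (S i)]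
  [∀ i, Module ℂ (S i)]

/-- The embedding of the `p`-th factor, with the other factors filled by `v`. -/
def factorEmb (v : ∀ i, S i) (p : ι) : S p →ₗ[ℂ] ⨂[ℂ] i, S i :=
  (PiTensorProduct.tprod ℂ).toLinearMap v p

theorem factorEmb_apply (v : ∀ i, S i) (p : ι) (a : S p) :
    factorEmb v p a = PiTensorProduct.tprod ℂ (Function.update v p a) := rfl

end FactorEmb

section PiTensor

variable {ι : Type*} [Fintype ι] {S : ι → Type*} [∀ i, AddCommGroup (S i)] [∀ i, Module ℂ (S i)]

/-- The functional `⨂ᵢ vᵢ ↦ ∏ᵢ ψᵢ(vᵢ)`. -/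
def piFunctional (ψ : ∀ i, S i →ₗ[ℂ] ℂ) : (⨂[ℂ] i, S i) →ₗ[ℂ] ℂ :=
  PiTensorProduct.lift ((MultilinearMap.mkPiAlgebra ℂ ι ℂ).compLinearMap ψ)

theorem piFunctional_tprod (ψ : ∀ i, S i →ₗ[ℂ] ℂ) (v : ∀ i, S i) :
    piFunctional ψ (PiTensorProduct.tprod ℂ v) = ∏ i, ψ i (v i) := by
  simp [piFunctional]

variable [DecidableEq ι] {L : Type*} [LieRing L] [LieAlgebra ℂ L] [∀ i, LieRingModule L (S i)]
  [∀ i, LieModule ℂ L (S i)] (ψ : ∀ i, S i →ₗ[ℂ] ℂ) (v : ∀ i, S i)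

/-- The functional vanishes unless factor `q` is moved, so one Leibniz term survives. -/
theorem piFunctional_lie_tprod {q : ι} (hq : ψ q (v q) = 0) (hs : ∀ i, i ≠ q → ψ i (v i) = 1)
    (x : L) : piFunctional ψ ⁅x, PiTensorProduct.tprod ℂ v⁆ = ψ q ⁅x, v q⁆ := by
  rw [lie_tprod, map_sum, Finset.sum_eq_single q]
  · rw [piFunctional_tprod, Finset.prod_eq_single q]
    · simp
    · intro i _ hi
      rw [Function.update_of_ne hi, hs i hi]
    · simp
  · intro i _ hi
    rw [piFunctional_tprod]
    refine Finset.prod_eq_zero (Finset.mem_univ q) ?_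
    rw [Function.update_of_ne hi.symm, hq]
  · simp

/-- Both factors `p` and `q` must be moved for the functional not to vanish. Two operators can do
this in two ways, one operator on each factor. -/
theorem piFunctional_lie_lie_tprod {p q : ι} (hpq : p ≠ q) (hp : ψ p (v p) = 0)
    (hq : ψ q (v q) = 0) (hs : ∀ i, i ≠ p → i ≠ q → ψ i (v i) = 1) (x y : L) :
    piFunctional ψ ⁅x, ⁅y, PiTensorProduct.tprod ℂ v⁆⁆ =
      ψ p ⁅x, v p⁆ * ψ q ⁅y, v q⁆ + ψ q ⁅x, v q⁆ * ψ p ⁅y, v p⁆ := by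
  have key (i : ι) : piFunctional ψ ⁅x, PiTensorProduct.tprod ℂ (Function.update v i ⁅y, v i⁆)⁆ =
      if i = p then ψ q ⁅x, v q⁆ * ψ p ⁅y, v p⁆ else
        if i = q then ψ p ⁅x, v p⁆ * ψ q ⁅y, v q⁆ else 0 := by
    have two {a b : ι} (hab : a ≠ b) (ha : ψ a (v a) = 0) (hs : ∀ i, i ≠ a → i ≠ b → ψ i (v i) = 1) :
        piFunctional ψ ⁅x, PiTensorProduct.tprod ℂ (Function.update v b ⁅y, v b⁆)⁆ =
          ψ a ⁅x, v a⁆ * ψ b ⁅y, v b⁆ := by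
      rw [lie_tprod, map_sum, Finset.sum_eq_single a]
      · rw [piFunctional_tprod, ← Finset.prod_subset (Finset.subset_univ {a, b}),
          Finset.prod_pair hab]
        · simp [Function.update_of_ne hab, Function.update_of_ne hab.symm]
        · intro i _ hi
          simp only [Finset.mem_insert, Finset.mem_singleton, not_or] at hi
          rw [Function.update_of_ne hi.1, Function.update_of_ne hi.2, hs i hi.1 hi.2]
      · intro i _ hi
        rw [piFunctional_tprod]
        refine Finset.prod_eq_zero (Finset.mem_univ a) ?_
        rw [Function.update_of_ne hi.symm, Function.update_of_ne hab, ha]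
      · simp
    split_ifs with h1 h2
    · subst h1
      exact two hpq.symm hq fun i h1 h2 => hs i h2 h1
    · subst h2
      exact two hpq hp hs
    · rw [lie_tprod, map_sum]
      refine Finset.sum_eq_zero fun j _ => ?_
      rw [piFunctional_tprod]
      by_cases hj : j = p
      · refine Finset.prod_eq_zero (Finset.mem_univ q) ?_
        rw [Function.update_of_ne (by rw [hj]; exact hpq.symm), Function.update_of_ne (Ne.symm h2),
          hq]
      · refine Finset.prod_eq_zero (Finset.mem_univ p) ?_
        rw [Function.update_of_ne (Ne.symm hj), Function.update_of_ne (Ne.symm h1), hp]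
  rw [lie_tprod _ y, lie_sum, map_sum, Finset.sum_congr rfl fun i _ => key i,
    ← Finset.sum_subset (Finset.subset_univ {p, q}), Finset.sum_pair hpq, if_pos rfl,
    if_neg hpq.symm, if_pos rfl, add_comm]
  intro i _ hi
  simp only [Finset.mem_insert, Finset.mem_singleton, not_or] at hi
  rw [if_neg hi.1, if_neg hi.2]

theorem factorEmb_lie [Subsingleton ι] (p : ι) (x : L) (a : S p) :
    factorEmb v p ⁅x, a⁆ = ⁅x, factorEmb v p a⁆ := by
  rw [factorEmb_apply, factorEmb_apply, lie_tprod,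
    Finset.sum_eq_single p (fun i _ hi => (hi (Subsingleton.elim i p)).elim) (by simp)]
  simp

theorem factorEmb_injective [Subsingleton ι] (p : ι) :
    Function.Injective (factorEmb (S := S) v p) := by
  refine (injective_iff_map_eq_zero _).mpr fun a ha => ?_
  refine (Module.forall_dual_apply_eq_zero_iff ℂ a).mp fun ψ => ?_
  have h1 := congrArg (piFunctional (Function.update (fun i => (0 : S i →ₗ[ℂ] ℂ)) p ψ)) ha
  rw [map_zero, factorEmb_apply, piFunctional_tprod,
    Finset.prod_eq_single p (fun i _ hi => (hi (Subsingleton.elim i p)).elim) (by simp)] at h1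
  simpa using h1

end PiTensor

/-! ### Merging the two kinds of factors into one family -/

section SumTensor

variable {ι₁ ι₂ : Type*} [Fintype ι₁] [DecidableEq ι₁] [Fintype ι₂] [DecidableEq ι₂]
  (S : ι₁ ⊕ ι₂ → Type*) [∀ i, AddCommGroup (S i)] [∀ i, Module ℂ (S i)] {L : Type*} [LieRing L]
  [LieAlgebra ℂ L] [∀ i, LieRingModule L (S i)] [∀ i, LieModule ℂ L (S i)]

theorem tmulEquivDep_symm_lie (x : L) (w : ⨂[ℂ] i, S i) :
    (PiTensorProduct.tmulEquivDep ℂ S).symm ⁅x, w⁆ =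
      ⁅x, (PiTensorProduct.tmulEquivDep ℂ S).symm w⁆ := by
  induction w using PiTensorProduct.induction_on with
  | add a b ha hb => simp only [lie_add, map_add, ha, hb]
  | smul_tprod r v =>
    rw [lie_smul, map_smul, map_smul]
    have hr := lie_smul (R := ℂ) r x
      ((PiTensorProduct.tmulEquivDep ℂ S).symm (PiTensorProduct.tprod ℂ v))
    rw [hr]
    congr 1
    rw [lie_tprod, map_sum, Fintype.sum_sum_type]
    simp only [PiTensorProduct.tmulEquivDep_symm_apply, TensorProduct.LieModule.lie_tmul_right,
      lie_tprod, TensorProduct.sum_tmul, TensorProduct.tmul_sum]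
    congr 1
    · refine Finset.sum_congr rfl fun i _ => ?_
      congr 2
      funext j
      by_cases hj : j = i
      · subst hj; simp
      · rw [Function.update_of_ne hj, Function.update_of_ne (by simpa using hj)]
    · refine Finset.sum_congr rfl fun i _ => ?_
      congr 2
      funext j
      by_cases hj : j = i
      · subst hj; simp
      · rw [Function.update_of_ne hj, Function.update_of_ne (by simpa using hj)]

/-- Splitting a tensor product over a disjoint union, as an isomorphism of Lie modules. -/
def sumTensorEquiv : (⨂[ℂ] i, S i) ≃ₗ⁅ℂ, L⁆
    (⨂[ℂ] i, S (Sum.inl i)) ⊗[ℂ] (⨂[ℂ] j, S (Sum.inr j)) :=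
  { (PiTensorProduct.tmulEquivDep ℂ S).symm with
    map_lie' := fun {x w} => tmulEquivDep_symm_lie S x w }

end SumTensor

section Factors

variable {m n : ℕ} (l : Fin m → ℂˣ) (α : Fin m → ℂ) (h : Fin m → ℂ[X]) (μ : Fin n → ℂˣ)
  (β : Fin n → ℂ)

/-- The family of all factors of `OmegaTensor l α h μ β`. -/
def OmegaFactor : Fin m ⊕ Fin n → Type
  | .inl i => OmegaTriple (l i) (α i) (h i)
  | .inr j => OmegaPair (μ j) (β j)

instance : ∀ i, AddCommGroup (OmegaFactor l α h μ β i)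
  | .inl i => inferInstanceAs (AddCommGroup (OmegaTriple (l i) (α i) (h i)))
  | .inr j => inferInstanceAs (AddCommGroup (OmegaPair (μ j) (β j)))

instance : ∀ i, Module ℂ (OmegaFactor l α h μ β i)
  | .inl i => inferInstanceAs (Module ℂ (OmegaTriple (l i) (α i) (h i)))
  | .inr j => inferInstanceAs (Module ℂ (OmegaPair (μ j) (β j)))

instance : ∀ i, LieRingModule Vir (OmegaFactor l α h μ β i)
  | .inl i => inferInstanceAs (LieRingModule Vir (OmegaTriple (l i) (α i) (h i)))
  | .inr j => inferInstanceAs (LieRingModule Vir (OmegaPair (μ j) (β j)))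

instance : ∀ i, LieModule ℂ Vir (OmegaFactor l α h μ β i)
  | .inl i => inferInstanceAs (LieModule ℂ Vir (OmegaTriple (l i) (α i) (h i)))
  | .inr j => inferInstanceAs (LieModule ℂ Vir (OmegaPair (μ j) (β j)))

/-- `OmegaTensor l α h μ β` as one tensor product over all of its factors. -/
def omegaTensorEquiv : (⨂[ℂ] i, OmegaFactor l α h μ β i) ≃ₗ⁅ℂ, Vir⁆ OmegaTensor l α h μ β :=
  sumTensorEquiv (OmegaFactor l α h μ β)

theorem exists_omegaLike_omegaFactor (hα : ∀ i, α i ≠ 0) (hβ : ∀ j, β j ≠ 0) (i : Fin m ⊕ Fin n) :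
    ∃ l' e ε χ, OmegaLike (OmegaFactor l α h μ β i) l' e ε χ :=
  match i with
  | .inl i => ⟨l i, exists_omegaLike_omegaTriple (l i) (hα i) (h i)⟩
  | .inr j => ⟨μ j, exists_omegaLike_omegaPair (μ j) (hβ j)⟩

end Factors

/-! ### Embeddings that commute with `d_x` for large `x` -/

section EventuallyEmbeds

variable (M W : Type*) [AddCommGroup M] [Module ℂ M] [LieRingModule Vir M] [AddCommGroup W]
  [Module ℂ W] [LieRingModule Vir W]

/-- There is an injective linear map that commutes with `d_x` for all large `x`. -/
def EventuallyEmbeds : Prop :=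
  ∃ (j : M →ₗ[ℂ] W) (R : ℤ), Function.Injective j ∧
    ∀ x, R ≤ x → ∀ a, j ⁅Vir.d x, a⁆ = ⁅Vir.d x, j a⁆

variable {M W}

theorem EventuallyEmbeds.trans {M' : Type*} [AddCommGroup M'] [Module ℂ M'] [LieRingModule Vir M']
    (h : EventuallyEmbeds M W) (h' : EventuallyEmbeds W M') :
    EventuallyEmbeds M M' := by
  obtain ⟨j, R, hj, hR⟩ := h
  obtain ⟨j', R', hj', hR'⟩ := h'
  refine ⟨j' ∘ₗ j, max R R', hj'.comp hj, fun x hx a => ?_⟩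
  rw [LinearMap.comp_apply, hR x (le_of_max_le_left hx), hR' x (le_of_max_le_right hx),
    LinearMap.comp_apply]

theorem LieModuleEquiv.eventuallyEmbeds (e : M ≃ₗ⁅ℂ, Vir⁆ W) : EventuallyEmbeds M W :=
  ⟨(e : M →ₗ[ℂ] W), 0, e.injective, fun _ _ => LieModuleHom.map_lie (e : M →ₗ⁅ℂ, Vir⁆ W) _⟩

variable [LieModule ℂ Vir M] [LieModule ℂ Vir W]

/-- The map is `a ↦ a ⊗ v`: for large `x` the Leibniz term that acts on `v` vanishes. -/
theorem eventuallyEmbeds_of_tensor {V : Type*} [AddCommGroup V] [Module ℂ V]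
    [LieRingModule Vir V] [LieModule ℂ Vir V] {v : V} (hv : v ≠ 0) {R : ℤ}
    (hR : ∀ x, R ≤ x → ⁅Vir.d x, v⁆ = 0) : EventuallyEmbeds M (M ⊗[ℂ] V) := by
  refine ⟨(TensorProduct.mk ℂ M V).flip v, R, ?_, fun x hx a => ?_⟩
  · refine (injective_iff_map_eq_zero _).mpr fun a ha => ?_
    obtain ⟨f, hf⟩ := Module.Projective.exists_dual_ne_zero ℂ hv
    have := congrArg (TensorProduct.rid ℂ M ∘ f.lTensor M) ha
    simpa [hf] using this
  · simp [TensorProduct.LieModule.lie_tmul_right, hR x hx]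

/-- `w ↦ d_x d_y w`, as a function of `x` and `y` -/
def lieLie (W : Type*) [AddCommGroup W] [Module ℂ W] [LieRingModule Vir W] [LieModule ℂ Vir W] :
    W →ₗ[ℂ] (ℤ → ℤ → W) where
  toFun w x y := ⁅Vir.d x, ⁅Vir.d y, w⁆⁆
  map_add' v w := by funext x y; simp
  map_smul' r w := by funext x y; simp

theorem lieLie_apply (w : W) (x y : ℤ) : lieLie W w x y = ⁅Vir.d x, ⁅Vir.d y, w⁆⁆ := rfl

theorem map_antiDiff_pow_lieLie {j : M →ₗ[ℂ] W} {R : ℤ}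
    (hj : ∀ x, R ≤ x → ∀ a, j ⁅Vir.d x, a⁆ = ⁅Vir.d x, j a⁆) (r : ℕ) (a : M) {x y : ℤ}
    (hx : R ≤ x) (hy : R ≤ y) :
    j ((antiDiff M ^ r) (lieLie M a) x y) = (antiDiff W ^ r) (lieLie W (j a)) x y := by
  rw [← antiDiff_pow_map]
  refine antiDiff_pow_congr r (fun x y hx hy => ?_) x y hx hy
  rw [lieLie_apply, lieLie_apply, hj x hx, hj y hy]

end EventuallyEmbeds

/-! ### Nonvanishing in tensor products -/

section ManyFactors

open Polynomial

variable {ι : Type*} [Fintype ι] [DecidableEq ι] {S : ι → Type*} [∀ i, AddCommGroup (S i)]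
  [∀ i, Module ℂ (S i)] [∀ i, LieRingModule Vir (S i)] [∀ i, LieModule ℂ Vir (S i)]

theorem exists_lie_d_ne_zero [Nonempty ι] (hS : ∀ i, ∃ l e ε χ, OmegaLike (S i) l e ε χ) :
    ∃ a : ⨂[ℂ] i, S i, ∀ x, ⁅Vir.d x, a⁆ ≠ 0 := by
  choose l e ε χ hS using hS
  obtain ⟨q⟩ := ‹Nonempty ι›
  refine ⟨PiTensorProduct.tprod ℂ e, fun x hx => ?_⟩
  have h1 := piFunctional_lie_tprod (Function.update ε q (χ q)) e (q := q)
    (by simpa using (hS q).χ_self)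
    (fun i hi => by simpa [Function.update_of_ne hi] using (hS i).ε_self) (Vir.d x)
  rw [hx, map_zero, Function.update_self, (hS q).χ_lie] at h1
  exact (l q ^ x).ne_zero h1.symm

/-- Two factors suffice. Factor `q` supplies a pure exponential and factor `p` an exponential times
a polynomial of degree above `r`; the resulting symmetrised product is too large to be killed by `r`
differences. -/
theorem not_antiDiff_pow_lieLie_eq_zero [Nontrivial ι]
    (hS : ∀ i, ∃ l e ε χ, OmegaLike (S i) l e ε χ) {r : ℕ} (hr : Odd r) {R : ℤ}
    (h : ∀ a x y, R ≤ x → R ≤ y →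
      (antiDiff (⨂[ℂ] i, S i) ^ r) (lieLie (⨂[ℂ] i, S i) a) x y = 0) : False := by
  choose l e ε χ hS using hS
  obtain ⟨p, q, hpq⟩ := exists_pair_ne ι
  obtain ⟨e', ψ, u, hdeg, hu, hψ, hact⟩ := (hS p).exists_polynomial (r + 1)
  have h1 := piFunctional_lie_lie_tprod (L := Vir) (Function.update (Function.update ε q (χ q)) p ψ)
    (Function.update e p e') hpq (by simpa using hψ)
    (by simpa [Function.update_of_ne hpq.symm] using (hS q).χ_self)
    (fun i hip hiq => by
      simpa [Function.update_of_ne hip, Function.update_of_ne hiq] using (hS i).ε_self)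
  simp only [Function.update_self, Function.update_of_ne hpq.symm] at h1
  refine absurd hdeg (not_le.mpr (natDegree_lt_of_antiDiff_pow_eq_zero (l p) (l q) hr u hu R
    fun x y hx hy => ?_))
  rw [← map_zero (piFunctional (Function.update (Function.update ε q (χ q)) p ψ)),
    ← h (PiTensorProduct.tprod ℂ (Function.update e p e')) x y hx hy, ← antiDiff_pow_map]
  simp only [lieLie_apply, h1, hact, (hS q).χ_lie]

end ManyFactors

/-! ### Differences of `d_x d_y` on a single factor -/

section OmegaRelations

open Polynomial

/-- Here `d_x d_y a = μ^(x+y) a(∂ - x - y) (∂ - x - βy) (∂ - βx)`, so apart from functions of `x +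
y` the expression is quadratic in `x` and `y`. -/
theorem antiDiff_pow_omegaPairAction (μ : ℂˣ) (β : ℂ) (a : ℂ[X]) : (antiDiff ℂ[X] ^ 3)
    (fun x y => omegaPairAction μ β x (omegaPairAction μ β y a)) = 0 := by
  let c (k : ℂ) (i : ℕ) : ℤ → ℂ[X] := fun s =>
    C (((μ ^ s : ℂˣ) : ℂ) * k) * (a.comp (X - C (s : ℂ)) * X ^ i)
  have h1 : (fun x y => omegaPairAction μ β x (omegaPairAction μ β y a)) =
      antiMonomial 0 0 (c 1 2) + antiMonomial 1 0 (c (-(1 + β)) 1) +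
      antiMonomial 0 1 (c (-β) 1) + antiMonomial 2 0 (c β 0) + antiMonomial 1 1 (c (β ^ 2) 0) := by
    funext x y
    have h2 : (X - C (x : ℂ) - C (y : ℂ) : ℂ[X]) = X - C (((x + y : ℤ)) : ℂ) := by
      push_cast; rw [C_add]; ring
    simp only [Pi.add_apply, omegaPairAction_apply, mul_comp, comp_assoc, sub_comp,
      X_comp, C_comp, h2, antiMonomial, c, zpow_add, Units.val_mul, smul_eq_C_mul]
    simp only [C_mul, C_add, C_neg, C_pow, C_1]
    ring
  rw [h1]
  simp [antiDiff_pow_antiMonomial_eq_zero]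

theorem antiDiff_pow_lieLie_omegaPair (μ : ℂˣ) (β : ℂ) (a : OmegaPair μ β) :
    (antiDiff (OmegaPair μ β) ^ 3) (lieLie (OmegaPair μ β) a) = 0 := by
  have h1 : lieLie (OmegaPair μ β) a =
      fun x y => omegaPairAction μ β x (omegaPairAction μ β y a) := by
    funext x y
    rw [lieLie_apply, OmegaPair.lie_d, OmegaPair.lie_d]
  rw [h1]
  exact antiDiff_pow_omegaPairAction μ β a

/-- `f ↦ α (f' - (h - h(α)) / (t - α) f)`, the coefficient of `m ^ 2` in `omegaTripleCoeff`. -/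
def omegaTripleQuad (α : ℂ) (h f : ℂ[X]) : ℂ[X] := C α * (derivative f - diffQuot α h * f)

theorem omegaTripleCoeff_eq (α : ℂ) (h : ℂ[X]) (m : ℤ) (f : ℂ[X]) :
    omegaTripleCoeff α h m f = C (m : ℂ) * (h * f + C α * diffQuot α h * f - X * derivative f) +
      C (m : ℂ) ^ 2 * omegaTripleQuad α h f := by
  simp [omegaTripleCoeff, omegaTripleQuad]
  ring

/-- Differentiation lowers the degree, while multiplication by a nonzero polynomial does not, so the
two terms cannot cancel. -/
theorem omegaTripleQuad_ne_zero {α : ℂ} (hα : α ≠ 0) {h f : ℂ[X]} (hq : diffQuot α h ≠ 0)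
    (hf : f ≠ 0) : omegaTripleQuad α h f ≠ 0 := by
  refine mul_ne_zero (C_ne_zero.mpr hα) fun h1 => ?_
  have h2 := degree_derivative_lt hf
  rw [sub_eq_zero.mp h1, degree_mul] at h2
  have h3 := zero_le_degree_iff.mpr hq
  exact absurd h2 (not_lt.mpr (le_add_of_nonneg_left h3))

theorem exists_omegaTripleQuad_ne_zero {α : ℂ} (hα : α ≠ 0) (h : ℂ[X]) :
    ∃ f, omegaTripleQuad α h (omegaTripleQuad α h f) ≠ 0 := by
  by_cases hq : diffQuot α h = 0
  · refine ⟨X ^ 2, ?_⟩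
    simp [omegaTripleQuad, hq, hα]
  · exact ⟨1, omegaTripleQuad_ne_zero hα hq (omegaTripleQuad_ne_zero hα hq one_ne_zero)⟩

/-- On polynomials in `t` alone, the only term of `d_x d_y` of total degree 4 is `x² y² B(B f)`,
where `B` is the `m²`-coefficient of the action. All others have degree at most 3, and `24 = 4!`. -/
theorem antiDiff_pow_omegaTripleAction (l : ℂˣ) (α : ℂ) (h f : ℂ[X]) : (antiDiff ℂ[X][X] ^ 4)
    (fun x y => omegaTripleAction l α h x (omegaTripleAction l α h y (C f))) =
      fun x y => (24 * ((l ^ (x + y + 4) : ℂˣ) : ℂ)) •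
        (C (omegaTripleQuad α h (omegaTripleQuad α h f)) : ℂ[X][X]) := by
  let A (f : ℂ[X]) : ℂ[X] := h * f + C α * diffQuot α h * f - X * derivative f
  let B := omegaTripleQuad α h
  let c (P : ℂ[X][X]) : ℤ → ℂ[X][X] := fun s => ((l ^ s : ℂˣ) : ℂ) • P
  have h1 : (fun x y => omegaTripleAction l α h x (omegaTripleAction l α h y (C f))) =
      antiMonomial 0 0 (c (X ^ 2 * C f)) + antiMonomial 1 0 (c (X * C (A f) - X * C f)) +
      antiMonomial 2 0 (c (X * C (B f) - C (A f))) + antiMonomial 3 0 (c (- C (B f))) +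
      antiMonomial 0 1 (c (X * C (A f))) + antiMonomial 0 2 (c (X * C (B f))) +
      antiMonomial 1 1 (c (C (A (A f)))) + antiMonomial 2 1 (c (C (B (A f)))) +
      antiMonomial 1 2 (c (C (A (B f)))) + antiMonomial 2 2 (c (C (B (B f)))) := by
    funext x y
    have h0 (m : ℤ) (g : ℂ[X]) := omegaTripleAction_C_mul_X_pow l α h m 0 g
    have h1 (m : ℤ) (g : ℂ[X]) := omegaTripleAction_C_mul_X_pow l α h m 1 g
    simp only [pow_one, pow_zero, one_mul, mul_one] at h0 h1
    have hs (r : ℂ) (Q : ℂ[X][X]) : r • Q = C (C r) * Q := by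
      rw [← smul_eq_C_mul, ← algebraMap_eq, algebraMap_smul]
    have hm (m : ℤ) (g : ℂ[X]) : omegaTripleCoeff α h m g =
        C (m : ℂ) * A g + C (m : ℂ) ^ 2 * B g := omegaTripleCoeff_eq α h m g
    have hlin (r : ℂ) (f g : ℂ[X]) : A (C r * f + C r ^ 2 * g) = C r * A f + C r ^ 2 * A g ∧
        B (C r * f + C r ^ 2 * g) = C r * B f + C r ^ 2 * B g := by
      simp only [A, B, omegaTripleQuad, ← C_pow, derivative_add, derivative_C_mul]
      constructor <;> ring
    rw [h0, map_smul, map_add, mul_comm X (C f), h1, h0]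
    simp only [Pi.add_apply, antiMonomial, c, hm, (hlin _ _ _).1, (hlin _ _ _).2, zpow_add,
      Units.val_mul, hs, C_mul, C_add, C_pow]
    ring
  have h2 : (antiDiff ℂ[X][X] ^ 4) (antiMonomial 2 2 (c (C (B (B f))))) = fun x y =>
      (24 * ((l ^ (x + y + 4) : ℂˣ) : ℂ)) • (C (B (B f)) : ℂ[X][X]) := by
    refine (antiDiff_pow_antiMonomial 2 2 _).trans ?_
    funext x y
    norm_num [c, Nat.factorial, smul_smul]
  rw [h1, map_add, h2]
  simp [antiDiff_pow_antiMonomial_eq_zero, B]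

theorem antiDiff_pow_lieLie_omegaTriple (l : ℂˣ) (α : ℂ) (h f : ℂ[X]) :
    (antiDiff (OmegaTriple l α h) ^ 4) (lieLie (OmegaTriple l α h) (C f : ℂ[X][X])) =
      fun x y => (24 * ((l ^ (x + y + 4) : ℂˣ) : ℂ)) •
        (C (omegaTripleQuad α h (omegaTripleQuad α h f)) : ℂ[X][X]) := by
  have h1 (a : OmegaTriple l α h) : lieLie (OmegaTriple l α h) a =
      fun x y => omegaTripleAction l α h x (omegaTripleAction l α h y a) := by
    funext x y
    rw [lieLie_apply, OmegaTriple.lie_d, OmegaTriple.lie_d]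
  exact (congrArg _ (h1 _)).trans (antiDiff_pow_omegaTripleAction l α h f)

end OmegaRelations

/-! ### Vectors killed by `d_i` for all large `i` -/

section EventuallyKilled

theorem Vir.span_range_d_c : Submodule.span ℂ (insert Vir.c (Set.range Vir.d)) = ⊤ := by
  rw [eq_top_iff, ← Vir.basis.span_eq]
  refine Submodule.span_mono ?_
  rintro _ ⟨i | _, rfl⟩
  · exact Or.inr ⟨i, rfl⟩
  · exact Or.inl rfl

/-- A subspace that is stable under all `d_i` and under `c` is a submodule. -/
theorem Vir.lie_mem_of_d_c {W : Type*} [AddCommGroup W] [Module ℂ W] [LieRingModule Vir W]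
    [LieModule ℂ Vir W] {p : Submodule ℂ W} (hd : ∀ i, ∀ w ∈ p, ⁅Vir.d i, w⁆ ∈ p)
    (hc : ∀ w ∈ p, ⁅Vir.c, w⁆ ∈ p) (x : Vir) {w : W} (hw : w ∈ p) : ⁅x, w⁆ ∈ p := by
  have hx : x ∈ Submodule.span ℂ (insert Vir.c (Set.range Vir.d)) := by
    rw [Vir.span_range_d_c]; trivial
  induction hx using Submodule.span_induction with
  | mem x hx =>
    obtain rfl | ⟨i, rfl⟩ := hx
    · exact hc w hw
    · exact hd i w hw
  | zero => rw [zero_lie]; exact p.zero_mem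
  | add x y _ _ hx hy => rw [add_lie]; exact p.add_mem hx hy
  | smul r x _ hx => rw [smul_lie]; exact p.smul_mem r hx

theorem Vir.lie_d_d_of_pos {W : Type*} [AddCommGroup W] [Module ℂ W] [LieRingModule Vir W]
    [LieModule ℂ Vir W] {i j : ℤ} (h : 0 < i + j) (w : W) : ⁅Vir.d i, ⁅Vir.d j, w⁆⁆ =
      ⁅Vir.d j, ⁅Vir.d i, w⁆⁆ + ((j : ℂ) - i) • ⁅Vir.d (i + j), w⁆ := by
  rw [leibniz_lie, Vir.lie_d_d, if_neg (by omega), add_zero, smul_lie, add_comm]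

variable (W : Type*) [AddCommGroup W] [Module ℂ W] [LieRingModule Vir W] [LieModule ℂ Vir W]

/-- The subspace of all vectors that are annihilated by `d_i` for all large `i`. -/
def eventuallyKilledSubspace : Submodule ℂ W :=
  { carrier := {w | ∃ R : ℤ, ∀ i, R ≤ i → ⁅Vir.d i, w⁆ = 0}
    add_mem' := by
      rintro v w ⟨R, hR⟩ ⟨S, hS⟩
      refine ⟨max R S, fun i hi => ?_⟩
      rw [lie_add, hR i (le_of_max_le_left hi), hS i (le_of_max_le_right hi), add_zero]
    zero_mem' := ⟨0, fun i _ => lie_zero _⟩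
    smul_mem' := by
      rintro r w ⟨R, hR⟩
      exact ⟨R, fun i hi => by rw [lie_smul, hR i hi, smul_zero]⟩ }

/-- `eventuallyKilledSubspace` as a submodule over the Virasoro algebra. -/
def eventuallyKilled : LieSubmodule ℂ Vir W :=
  { eventuallyKilledSubspace W with
    lie_mem := by
      intro x w hw
      refine Vir.lie_mem_of_d_c (p := eventuallyKilledSubspace W) (fun j w hw => ?_) (fun w hw => ?_) x hw
      · obtain ⟨R, hR⟩ := hw
        -- The bounds ensure that `d_i` and `d_(i+j)` kill `w` and that `i + j > 0`, so that no
        -- central term appears.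
        refine ⟨max (max R (R - j)) (1 - j), fun i hi => ?_⟩
        simp only [max_le_iff] at hi
        rw [Vir.lie_d_d_of_pos (by omega), hR i hi.1.1, hR (i + j) (by omega), lie_zero, smul_zero,
          add_zero]
      · obtain ⟨R, hR⟩ := hw
        refine ⟨R, fun i hi => ?_⟩
        rw [leibniz_lie, Vir.lie_c, zero_lie, hR i hi, lie_zero, add_zero] }

variable {W}

theorem mem_eventuallyKilled {w : W} :
    w ∈ eventuallyKilled W ↔ ∃ R : ℤ, ∀ i, R ≤ i → ⁅Vir.d i, w⁆ = 0 := Iff.rfl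

theorem not_eventuallyEmbeds_of_eventuallyKilled {M : Type*} [AddCommGroup M] [Module ℂ M]
    [LieRingModule Vir M] [LieModule ℂ Vir M] (hM : ∃ a : M, ∀ x, ⁅Vir.d x, a⁆ ≠ 0)
    (hW : ∀ w, w ∈ eventuallyKilled W) : ¬ EventuallyEmbeds M W := by
  rintro ⟨j, R, hj, hR⟩
  obtain ⟨a, ha⟩ := hM
  obtain ⟨S, hS⟩ := hW (j a)
  refine ha (max R S) (hj ?_)
  rw [hR _ (le_max_left R S), hS _ (le_max_right R S), map_zero]

end EventuallyKilled

/-! ### Induced modules -/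

section Induced

variable {N : Type*} [AddCommGroup N] [Module ℂ N] [LieRingModule VirPlus N]
  [LieModule ℂ VirPlus N]

theorem Induced.mk_mul_tmul (u : UniversalEnvelopingAlgebra ℂ Vir) (x : VirPlus) (v : N) :
    Induced.mk N ((u * UniversalEnvelopingAlgebra.ι ℂ (x : Vir)) ⊗ₜ[ℂ] v) =
      Induced.mk N (u ⊗ₜ[ℂ] ⁅x, v⁆) := by
  refine (Submodule.Quotient.eq _).mpr (Submodule.subset_span
    ⟨u, UniversalEnvelopingAlgebra.ι ℂ x, v, ?_⟩)
  simp [envelopingIncl, envelopingAction]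

/-- The vectors `1 ⊗ v` generate: the elements of `U(Vir)` that preserve membership in `P` form a
subalgebra containing `Vir`. -/
theorem Induced.mk_tmul_mem {P : LieSubmodule ℂ Vir (Induced N)}
    (h : ∀ v, Induced.mk N (1 ⊗ₜ[ℂ] v) ∈ P) (u : UniversalEnvelopingAlgebra ℂ Vir) (v : N) :
    Induced.mk N (u ⊗ₜ[ℂ] v) ∈ P := by
  let Q : Subalgebra ℂ (UniversalEnvelopingAlgebra ℂ Vir) :=
    { carrier := {a | ∀ u, Induced.mk N (u ⊗ₜ[ℂ] v) ∈ P → Induced.mk N ((a * u) ⊗ₜ[ℂ] v) ∈ P}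
      mul_mem' := fun {a b} ha hb u hu => by rw [mul_assoc]; exact ha _ (hb _ hu)
      add_mem' := fun {a b} ha hb u hu => by
        rw [add_mul, TensorProduct.add_tmul, map_add]
        exact P.add_mem (ha u hu) (hb u hu)
      algebraMap_mem' := fun r u hu => by
        rw [← Algebra.smul_def, ← TensorProduct.smul_tmul', map_smul]
        exact P.smul_mem r hu }
  have hQ : Q = ⊤ := by
    let f : Vir →ₗ⁅ℂ⁆ Q :=
      { toFun x := ⟨UniversalEnvelopingAlgebra.ι ℂ x, fun u hu => by
          rw [← Induced.lie_mk]; exact P.lie_mem hu⟩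
        map_add' x y := Subtype.ext (map_add _ x y)
        map_smul' r x := Subtype.ext (map_smul _ r x)
        map_lie' {x y} := Subtype.ext (LieHom.map_lie _ x y) }
    -- By the universal property, the composite `U(Vir) → Q → U(Vir)` is the identity, so `Q` is
    -- everything.
    have hf : Q.val.comp (UniversalEnvelopingAlgebra.lift ℂ f) = AlgHom.id ℂ _ := by
      ext x
      simp [f]
    refine eq_top_iff.mpr fun a _ => ?_
    have := AlgHom.congr_fun hf a
    rw [AlgHom.id_apply] at this
    rw [← this]
    exact (UniversalEnvelopingAlgebra.lift ℂ f a).2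
  have hu : u ∈ Q := by rw [hQ]; trivial
  simpa using hu 1 (h v)

theorem Induced.mem_eventuallyKilled {k : ℕ} (hk : ∀ i : ℕ, k < i → ∀ v : N, ⁅VirPlus.d i, v⁆ = 0)
    (w : Induced N) : w ∈ eventuallyKilled (Induced N) := by
  obtain ⟨w, rfl⟩ := (inducedRel N).mkQ_surjective w
  induction w using TensorProduct.induction_on with
  | zero => rw [map_zero]; exact zero_mem _
  | add x y hx hy => rw [map_add]; exact add_mem hx hy
  | tmul u v =>
    refine Induced.mk_tmul_mem (fun v => _root_.mem_eventuallyKilled.mpr ⟨k + 1, fun i hi => ?_⟩) u v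
    obtain ⟨i, rfl⟩ := Int.eq_ofNat_of_zero_le (show 0 ≤ i by omega)
    have := Induced.mk_mul_tmul 1 (VirPlus.d i) v
    rw [hk i (by omega) v, TensorProduct.tmul_zero, map_zero, one_mul] at this
    rw [Induced.lie_mk, mul_one]
    exact this

theorem InducedTheta.mem_eventuallyKilled {k : ℕ}
    (hk : ∀ i : ℕ, k < i → ∀ v : N, ⁅VirPlus.d i, v⁆ = 0) (θ : ℂ) (w : InducedTheta N θ) :
    w ∈ eventuallyKilled (InducedTheta N θ) := by
  obtain ⟨w, rfl⟩ := LieSubmodule.Quotient.surjective_mk' (centralSubmodule N θ) w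
  obtain ⟨R, hR⟩ := Induced.mem_eventuallyKilled hk w
  refine ⟨R, fun i hi => ?_⟩
  rw [← LieModuleHom.map_lie, hR i hi, map_zero]

end Induced

/-! ### Differences of `d_x d_y` on `A_b` -/

section Twist

/-- Moving all powers of `t` to the left by `D t^y = t^y (D + y)` turns `d_x d_y` into `t^(x+y)`
times an expression of degree at most 2 in `x` and `y`. -/
theorem antiDiff_pow_lieLie_twist (b : ℂ) (A : Type*) [AddCommGroup A] [Module ℂ A]
    [Module laurentDiffOps A] [IsScalarTower ℂ laurentDiffOps A] (w : Twist b A) :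
    (antiDiff (Twist b A) ^ 3) (lieLie (Twist b A) w) = 0 := by
  let v : A := w
  let c (k : ℂ) (P : laurentDiffOps) : ℤ → A := fun s => k • opT s • P • v
  have hsmul (r : ℂ) (P : laurentDiffOps) (z : A) : P • r • z = r • P • z := by
    rw [← IsScalarTower.algebraMap_smul laurentDiffOps r z,
      ← IsScalarTower.algebraMap_smul laurentDiffOps r (P • z), ← mul_smul, ← mul_smul,
      Algebra.commutes]
  have hT (x y : ℤ) (z : A) : opT x • opT y • z = opT (x + y) • z := by rw [← mul_smul, opT_mul]
  have hD (y : ℤ) (z : A) : opD • opT y • z = opT y • opD • z + (y : ℂ) • opT y • z := by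
    rw [← mul_smul, opD_mul_opT, add_smul, mul_smul, smul_assoc]
  have h1 : (fun x y => twistAction b A x (twistAction b A y v)) =
      antiMonomial 0 0 (c 1 (opD * opD)) + antiMonomial 0 1 (c (1 + b) opD) +
      antiMonomial 1 0 (c b opD) + antiMonomial 0 2 (c b 1) + antiMonomial 1 1 (c (b ^ 2) 1) := by
    funext x y
    simp only [Pi.add_apply, antiMonomial, c, twistAction_apply, smul_add, hsmul, hD, hT, mul_smul,
      one_smul]
    generalize opT (x + y) • opD • opD • v = z₂
    generalize opT (x + y) • opD • v = z₁
    generalize opT (x + y) • v = z₀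
    module
  have h2 : (antiDiff A ^ 3) (fun x y => twistAction b A x (twistAction b A y v)) = 0 := by
    rw [h1]
    simp [antiDiff_pow_antiMonomial_eq_zero]
  have h3 : lieLie (Twist b A) w = fun x y => twistAction b A x (twistAction b A y v) := by
    funext x y
    rw [lieLie_apply, Twist.lie_d, Twist.lie_d]
  rw [h3]
  exact h2

end Twist

/-! ### Differences of `d_x d_y` on `N(M, γ)` -/

section Loop

variable (k : ℕ) (M : Type*) [AddCommGroup M] [Module ℂ M] [LieRingModule (TruncatedVir k) M]
  [LieModule ℂ (TruncatedVir k) M] (γ : ℂ[T;T⁻¹])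

/-- The operator `v ⊗ f ↦ d̄_k d̄_k v ⊗ g f`. -/
def loopLead (g : ℂ[T;T⁻¹]) : Module.End ℂ (M ⊗[ℂ] ℂ[T;T⁻¹]) :=
  TensorProduct.map (LieModule.toEnd ℂ (TruncatedVir k) M (TruncatedVir.d k k) ^ 2)
    (LinearMap.mulLeft ℂ g)

theorem loopLead_injective
    (hinj : Function.Injective (fun v : M => ⁅TruncatedVir.d k k, v⁆)) {g : ℂ[T;T⁻¹]} (hg : g ≠ 0) :
    Function.Injective (loopLead k M g) := by
  refine TensorProduct.map_injective_of_flat_flat _ _ ?_ (fun a b hab => mul_left_cancel₀ hg hab)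
  intro a b hab
  rw [pow_two] at hab
  exact hinj (hinj hab)

/-- The scalar in the top antidiagonal difference of `d_x d_y` on `LoopModule k M γ`. -/
def loopScalar : ℂ :=
  (1 / (k + 1).factorial) ^ 2 * ((-1) ^ (k + 1) * ((k + 1 + (k + 1)).factorial : ℂ))

theorem loopScalar_ne_zero : loopScalar k ≠ 0 := by
  simp [loopScalar, Nat.factorial_ne_zero]

/-- The total degree in `x` and `y` is at most `2k + 2`, attained only by `x^(k+1) y^(k+1)` with
coefficient built from `d̄_k²`. The condition `k ≥ 1` is needed for the terms `y^(i+2)`, `i ≤ k`, to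
have smaller degree. -/
theorem antiDiff_pow_loopAction_tmul (hk : 1 ≤ k) (v : M) (f : ℂ[T;T⁻¹]) :
    (antiDiff (M ⊗[ℂ] ℂ[T;T⁻¹]) ^ (k + 1 + (k + 1)))
      (fun x y => loopAction k M γ x (loopAction k M γ y (v ⊗ₜ f))) =
      fun x y => loopScalar k •
        loopLead k M (LaurentPolynomial.T (x + y + (k + 1 + (k + 1) : ℕ))) (v ⊗ₜ f) := by
  -- Only the commutation of `G = t d/dt + γ` with powers of `t` matters, so `γ` is hidden inside
  -- `G`.
  obtain ⟨G, hG, hA⟩ : ∃ G : ℂ[T;T⁻¹] → ℂ[T;T⁻¹],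
      (∀ (m : ℤ) (g : ℂ[T;T⁻¹]), G (LaurentPolynomial.T m * g) =
        LaurentPolynomial.T m * G g + (m : ℂ) • (LaurentPolynomial.T m * g)) ∧
      ∀ (m : ℤ) (u : M) (g : ℂ[T;T⁻¹]), loopAction k M γ m (u ⊗ₜ g) =
        u ⊗ₜ (LaurentPolynomial.T m * G g) +
          ⁅truncSeries k m, u⁆ ⊗ₜ (LaurentPolynomial.T m * g) := by
    refine ⟨fun g => euler g + γ * g, fun m g => ?_, loopAction_tmul k M γ⟩
    simp only [euler_T_mul]
    ring
  obtain ⟨e, he⟩ : ∃ e : ℕ → ℂ, ∀ i, e i = 1 / (i + 1).factorial := ⟨_, fun _ => rfl⟩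
  let c (r : ℂ) (u : M) (g : ℂ[T;T⁻¹]) : ℤ → M ⊗[ℂ] ℂ[T;T⁻¹] := fun s =>
    r • (u ⊗ₜ (LaurentPolynomial.T s * g))
  obtain ⟨d, hd⟩ : ∃ d : ℕ → Module.End ℂ M, ∀ i u, d i u = ⁅TruncatedVir.d k i, u⁆ :=
    ⟨fun i => LieModule.toEnd ℂ (TruncatedVir k) M (TruncatedVir.d k i), fun _ _ => rfl⟩
  have hX (m : ℤ) (u : M) : ⁅truncSeries k m, u⁆ =
      ∑ i ∈ Finset.range (k + 1), (e i * (m : ℂ) ^ (i + 1)) • d i u := by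
    rw [truncSeries, sum_lie]
    refine Finset.sum_congr rfl fun i _ => ?_
    rw [smul_lie, hd]
    congr 1
    rw [he]
    ring
  have hT (a b : ℤ) (g : ℂ[T;T⁻¹]) : LaurentPolynomial.T a * (LaurentPolynomial.T b * g) =
      LaurentPolynomial.T (a + b) * g := by rw [LaurentPolynomial.T_add, mul_assoc]
  have h1 : (fun x y => loopAction k M γ x (loopAction k M γ y (v ⊗ₜ f))) =
      antiMonomial 0 0 (c 1 v (G (G f))) + antiMonomial 0 1 (c 1 v (G f)) +
      ∑ i ∈ Finset.range (k + 1), antiMonomial (i + 1) 0 (c (e i) (d i v) (G f)) +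
      ∑ i ∈ Finset.range (k + 1), antiMonomial 0 (i + 1) (c (e i) (d i v) (G f)) +
      ∑ i ∈ Finset.range (k + 1), antiMonomial 0 (i + 2) (c (e i) (d i v) f) +
      ∑ j ∈ Finset.range (k + 1), ∑ i ∈ Finset.range (k + 1),
        antiMonomial (i + 1) (j + 1) (c (e i * e j) (d i (d j v)) f) := by
    funext x y
    have hXt (m : ℤ) (u : M) (g : ℂ[T;T⁻¹]) : ⁅truncSeries k m, u⁆ ⊗ₜ[ℂ] g =
        ∑ i ∈ Finset.range (k + 1), (e i * (m : ℂ) ^ (i + 1)) • (d i u ⊗ₜ[ℂ] g) := by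
      simp only [hX, TensorProduct.sum_tmul, TensorProduct.smul_tmul']
    have b1 : ∑ i ∈ Finset.range (k + 1), antiMonomial (i + 1) 0 (c (e i) (d i v) (G f)) x y =
        ⁅truncSeries k x, v⁆ ⊗ₜ (LaurentPolynomial.T (x + y) * G f) := by
      rw [hXt]
      refine Finset.sum_congr rfl fun i _ => ?_
      simp only [antiMonomial, c, smul_smul]
      ring_nf
    have b2 : ∑ i ∈ Finset.range (k + 1), antiMonomial 0 (i + 1) (c (e i) (d i v) (G f)) x y =
        ⁅truncSeries k y, v⁆ ⊗ₜ (LaurentPolynomial.T (x + y) * G f) := by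
      rw [hXt]
      refine Finset.sum_congr rfl fun i _ => ?_
      simp only [antiMonomial, c, smul_smul]
      ring_nf
    have b3 : ∑ i ∈ Finset.range (k + 1), antiMonomial 0 (i + 2) (c (e i) (d i v) f) x y =
        (y : ℂ) • (⁅truncSeries k y, v⁆ ⊗ₜ (LaurentPolynomial.T (x + y) * f)) := by
      rw [hXt, Finset.smul_sum]
      refine Finset.sum_congr rfl fun i _ => ?_
      simp only [antiMonomial, c, smul_smul]
      ring_nf
    have b4 : ∑ j ∈ Finset.range (k + 1), ∑ i ∈ Finset.range (k + 1),
        antiMonomial (i + 1) (j + 1) (c (e i * e j) (d i (d j v)) f) x y =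
        ⁅truncSeries k x, ⁅truncSeries k y, v⁆⁆ ⊗ₜ (LaurentPolynomial.T (x + y) * f) := by
      rw [hX y, lie_sum, TensorProduct.sum_tmul]
      refine Finset.sum_congr rfl fun j _ => ?_
      rw [lie_smul, ← TensorProduct.smul_tmul', hXt, Finset.smul_sum]
      refine Finset.sum_congr rfl fun i _ => ?_
      simp only [antiMonomial, c, smul_smul]
      ring_nf
    simp only [Pi.add_apply, Finset.sum_apply]
    rw [b1, b2, b3, b4, hA, map_add, hA, hA, hG, hG, mul_add, mul_add, mul_smul_comm,
      mul_smul_comm, hT, hT, hT, TensorProduct.tmul_add, TensorProduct.tmul_add,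
      TensorProduct.tmul_smul, TensorProduct.tmul_smul]
    simp only [antiMonomial, c, pow_zero, one_mul, pow_one, one_smul]
    abel
  have h2 (j : ℕ) (hj : j ∈ Finset.range (k + 1)) : (antiDiff (M ⊗[ℂ] ℂ[T;T⁻¹]) ^ (k + 1 + (k + 1)))
      (∑ i ∈ Finset.range (k + 1),
        antiMonomial (i + 1) (j + 1) (c (e i * e j) (d i (d j v)) f)) =
      if j = k then fun x y => loopScalar k •
        loopLead k M (LaurentPolynomial.T (x + y + (k + 1 + (k + 1) : ℕ))) (v ⊗ₜ f) else 0 := by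
    have hj' := Finset.mem_range.mp hj
    split_ifs with hjk
    · subst hjk
      rw [map_sum, Finset.sum_range_succ, Finset.sum_eq_zero, zero_add, antiDiff_pow_antiMonomial]
      · funext x y
        simp only [c, smul_smul, loopScalar, he, hd]
        refine congrArg₂ (· • ·) ?_ rfl
        ring
      · intro i hi
        have := Finset.mem_range.mp hi
        exact antiDiff_pow_antiMonomial_eq_zero (by omega) _
    · rw [map_sum]
      refine Finset.sum_eq_zero fun i hi => ?_
      have := Finset.mem_range.mp hi
      exact antiDiff_pow_antiMonomial_eq_zero (by omega) _
  have h3 (a b : ℕ → ℕ) (c : ℕ → ℤ → M ⊗[ℂ] ℂ[T;T⁻¹])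
      (h : ∀ i ≤ k, a i + b i < k + 1 + (k + 1)) : (antiDiff (M ⊗[ℂ] ℂ[T;T⁻¹]) ^ (k + 1 + (k + 1)))
      (∑ i ∈ Finset.range (k + 1), antiMonomial (a i) (b i) (c i)) = 0 := by
    rw [map_sum]
    refine Finset.sum_eq_zero fun i hi => ?_
    have := Finset.mem_range.mp hi
    exact antiDiff_pow_antiMonomial_eq_zero (h i (by omega)) _
  simp only [h1, map_add]
  rw [antiDiff_pow_antiMonomial_eq_zero (by omega), antiDiff_pow_antiMonomial_eq_zero (by omega),
    h3 (fun i => i + 1) (fun _ => 0) _ (by intros; omega),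
    h3 (fun _ => 0) (fun i => i + 1) _ (by intros; omega),
    h3 (fun _ => 0) (fun i => i + 2) _ (by intros; omega), map_sum, Finset.sum_congr rfl h2,
    Finset.sum_ite_eq' (Finset.range (k + 1)) k, if_pos (by simp)]
  simp

theorem antiDiff_pow_lieLie_loopModule (hk : 1 ≤ k) (w : LoopModule k M γ) :
    (antiDiff (LoopModule k M γ) ^ (k + 1 + (k + 1))) (lieLie (LoopModule k M γ) w) =
      fun x y => loopScalar k •
        loopLead k M (LaurentPolynomial.T (x + y + (k + 1 + (k + 1) : ℕ))) w := by
  have h1 : lieLie (LoopModule k M γ) w =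
      fun x y => loopAction k M γ x (loopAction k M γ y w) := by
    funext x y
    rw [lieLie_apply, LoopModule.lie_d, LoopModule.lie_d]
  rw [h1]
  have h2 (w : M ⊗[ℂ] ℂ[T;T⁻¹]) : (antiDiff (M ⊗[ℂ] ℂ[T;T⁻¹]) ^ (k + 1 + (k + 1)))
      (fun x y => loopAction k M γ x (loopAction k M γ y w)) =
      fun x y => loopScalar k •
        loopLead k M (LaurentPolynomial.T (x + y + (k + 1 + (k + 1) : ℕ))) w := by
    induction w using TensorProduct.induction_on with
    | zero =>
      simp only [map_zero, smul_zero]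
      exact map_zero _
    | add a b ha hb =>
      simp only [map_add, smul_add]
      refine (map_add (antiDiff (M ⊗[ℂ] ℂ[T;T⁻¹]) ^ (k + 1 + (k + 1)))
        (fun x y => loopAction k M γ x (loopAction k M γ y a))
        (fun x y => loopAction k M γ x (loopAction k M γ y b))).trans ?_
      rw [ha, hb]
      rfl
    | tmul v f => exact antiDiff_pow_loopAction_tmul k M γ hk v f
  exact h2 w

end Loop

/-! ### From local finiteness to eventually killed vectors -/

section LocallyFinite

open Polynomial

/-- A nonzero root of `p` has smaller multiplicity in `p'`, so `p` can have no root other than 0. -/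
theorem Polynomial.exists_dvd_X_pow {p : ℂ[X]} (hp : p ≠ 0) {m : ℕ}
    (h : p ∣ X ^ m * derivative p) : ∃ N : ℕ, p ∣ X ^ N := by
  obtain ⟨q, hq, hXq⟩ := exists_eq_pow_rootMultiplicity_mul_and_not_dvd p hp 0
  rw [C_0, sub_zero] at hq hXq
  generalize rootMultiplicity 0 p = a at hq
  have hcop : IsCoprime q X := ((irreducible_X.coprime_iff_not_dvd).mpr hXq).symm
  have h1 : X ^ a * q ∣ X ^ a * (X ^ m * (C (a : ℂ) * q + X * derivative q)) := by
    have h2 : X * (X ^ m * derivative p) =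
        X ^ a * (X ^ m * (C (a : ℂ) * q + X * derivative q)) := by
      rw [hq, derivative_mul, derivative_X_pow]
      rcases a with _ | a
      · simp
        ring
      · simp only [Nat.add_sub_cancel]
        ring
    rw [← h2, ← hq]
    exact h.mul_left X
  have h3 := hcop.pow_right.dvd_of_dvd_mul_left
    ((mul_dvd_mul_iff_left (pow_ne_zero a X_ne_zero)).mp h1)
  have h4 : q ∣ derivative q :=
    hcop.dvd_of_dvd_mul_left ((dvd_add_right (dvd_mul_left q (C (a : ℂ)))).mp h3)
  have hq0 : q ≠ 0 := fun h0 => hXq (h0 ▸ dvd_zero X)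
  have h5 : derivative q = 0 := by
    by_contra h0
    exact absurd (degree_le_of_dvd h4 h0) (not_le.mpr (degree_derivative_lt hq0))
  have h6 := derivative_eq_zero.mp h5
  obtain ⟨r, rfl⟩ := natDegree_eq_zero.mp h6
  have hr : r ≠ 0 := fun h0 => hq0 (by rw [h0, C_0])
  refine ⟨a, ?_⟩
  rw [hq]
  exact (isUnit_C.mpr (IsUnit.mk0 r hr)).mul_right_dvd.mpr dvd_rfl

/-- The linear map `t ^ i ↦ d_{n + i}`. -/
def virPoly (n : ℕ) : ℂ[X] →ₗ[ℂ] Vir :=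
  (Polynomial.basisMonomials ℂ).constr ℂ fun i : ℕ => Vir.d ((n + i : ℕ) : ℤ)

theorem virPoly_monomial (n i : ℕ) (r : ℂ) :
    virPoly n (monomial i r) = r • Vir.d ((n + i : ℕ) : ℤ) := by
  have h1 := (Polynomial.basisMonomials ℂ).constr_basis ℂ
    (fun i : ℕ => Vir.d ((n + i : ℕ) : ℤ)) i
  rw [coe_basisMonomials] at h1
  rw [← mul_one r, ← smul_eq_mul, ← smul_monomial, map_smul, virPoly, h1, smul_eq_mul, mul_one]

/-- The bracket of vector fields `t ^ m f d/dt`. -/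
def vectorFieldBracket (m : ℕ) (f g : ℂ[X]) : ℂ[X] :=
  X ^ m * (f * derivative g - derivative f * g)

/-- Under `d_i ↔ t^(i+1) d/dt` the polynomial `f` stands for `t^(n+1) f d/dt`. For `n ≥ 1` only
positive indices occur, hence no central term. -/
theorem virPoly_lie {n : ℕ} (hn : 1 ≤ n) (f g : ℂ[X]) :
    ⁅virPoly n f, virPoly n g⁆ = virPoly n (vectorFieldBracket (n + 1) f g) := by
  induction f using Polynomial.induction_on' with
  | add p q hp hq =>
    rw [map_add, add_lie, hp, hq, ← map_add]
    congr 1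
    simp only [vectorFieldBracket, map_add]
    ring
  | monomial i r =>
    induction g using Polynomial.induction_on' with
    | add p q hp hq =>
      rw [map_add, lie_add, hp, hq, ← map_add]
      congr 1
      simp only [vectorFieldBracket, map_add]
      ring
    | monomial j s =>
      have h1 : vectorFieldBracket (n + 1) (monomial i r) (monomial j s) =
          monomial (n + i + j) (r * s * ((j : ℂ) - i)) := by
        simp only [vectorFieldBracket, ← C_mul_X_pow_eq_monomial, derivative_C_mul_X_pow]
        rcases i with _ | i <;> rcases j with _ | j
        · simp
        all_goals
          simp only [Nat.add_sub_cancel, C_mul, C_sub, Nat.cast_zero, Nat.cast_add, Nat.cast_one,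
            C_0, C_1, C_add]
          ring
      rw [h1, virPoly_monomial, virPoly_monomial, virPoly_monomial, smul_lie, lie_smul,
        Vir.lie_d_d, if_neg (by omega), add_zero, smul_smul, smul_smul]
      congr 1
      · push_cast; ring
      · congr 1
        push_cast
        ring

theorem vectorFieldBracket_leibniz (m : ℕ) (f g h : ℂ[X]) :
    vectorFieldBracket m (vectorFieldBracket m f g) h =
      vectorFieldBracket m f (vectorFieldBracket m g h) -
        vectorFieldBracket m g (vectorFieldBracket m f h) := by
  generalize hs : (X ^ m : ℂ[X]) = s
  simp only [vectorFieldBracket, hs, derivative_mul, derivative_sub]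
  ring

/-- The combination is chosen so that all derivatives cancel. Since `k` is arbitrary, double
brackets starting from `f` thereby produce an ideal of polynomials. -/
theorem vectorFieldBracket_ideal (m : ℕ) (f k : ℂ[X]) :
    vectorFieldBracket m (vectorFieldBracket m f (X ^ 2 * k)) 1 -
      (2 : ℂ) • vectorFieldBracket m (vectorFieldBracket m f (X * k)) X +
      vectorFieldBracket m (vectorFieldBracket m f k) (X ^ 2) =
    (-4 : ℂ) • ((X ^ m) ^ 2 * f * k) := by
  generalize hs : (X ^ m : ℂ[X]) = s
  simp only [vectorFieldBracket, hs, derivative_mul, derivative_sub, derivative_X_pow, derivative_X,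
    derivative_one, smul_eq_C_mul]
  simp [map_ofNat]
  ring

/-- A finite-codimensional Lie algebra of vector fields `t ^ m f d/dt` that is stable under
`t ^ m d/dt` contains all vector fields that vanish to high order at `0`. -/
theorem exists_X_pow_mul_mem {P : Type*} [AddCommGroup P] [Module ℂ P] [FiniteDimensional ℂ P]
    (φ : ℂ[X] →ₗ[ℂ] P) (m : ℕ)
    (hφ : ∀ f g, φ f = 0 → φ g = 0 → φ (vectorFieldBracket m f g) = 0)
    (h1 : ∀ f, φ f = 0 → φ (X ^ m * derivative f) = 0) :
    ∃ N : ℕ, ∀ k, φ (X ^ N * k) = 0 := by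
  let br : ℂ[X] →ₗ[ℂ] ℂ[X] →ₗ[ℂ] ℂ[X] := LinearMap.mk₂ ℂ (vectorFieldBracket m)
    (fun f f' g => by simp only [vectorFieldBracket, map_add]; ring)
    (fun r f g => by
      simp only [vectorFieldBracket, smul_eq_C_mul, derivative_C_mul]; ring)
    (fun f g g' => by simp only [vectorFieldBracket, map_add]; ring)
    (fun r f g => by
      simp only [vectorFieldBracket, smul_eq_C_mul, derivative_C_mul]; ring)
  have hbr (f g : ℂ[X]) : br f g = vectorFieldBracket m f g := rfl
  let b := Module.finBasis ℂ (LinearMap.range φ)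
  choose g hg using fun i => (b i).2
  have hdecomp (f : ℂ[X]) : ∃ c : Fin _ → ℂ, ∃ k, φ k = 0 ∧ f = ∑ i, c i • g i + k := by
    refine ⟨b.repr ⟨φ f, f, rfl⟩, f - ∑ i, b.repr ⟨φ f, f, rfl⟩ i • g i, ?_, by abel⟩
    have := congrArg Subtype.val (b.sum_repr ⟨φ f, f, rfl⟩)
    rw [map_sub, map_sum, sub_eq_zero]
    refine this.symm.trans ?_
    simp [-Module.Basis.sum_repr, hg]
  -- The vectors `g i` span a complement of the kernel of `φ`. Vanishing of `φ` on `f`, on `[f, g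
  -- i]` and on `[[f, g i], g j]` is a finite-dimensional condition, so some nonzero `f` meets it.
  let Φ : ℂ[X] →ₗ[ℂ] P × (Fin _ → P) × (Fin _ → Fin _ → P) :=
    φ.prod ((LinearMap.pi fun i => φ ∘ₗ br.flip (g i)).prod
      (LinearMap.pi fun i => LinearMap.pi fun j => φ ∘ₗ br.flip (g j) ∘ₗ br.flip (g i)))
  obtain ⟨f, hf, hf0⟩ : ∃ f, Φ f = 0 ∧ f ≠ 0 := by
    by_contra! hcon
    have hinj : Function.Injective Φ := (injective_iff_map_eq_zero _).mpr hcon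
    have := Module.Finite.of_injective Φ hinj
    exact Polynomial.not_finite this
  simp only [Φ, LinearMap.prod_apply, Function.prod_apply, Prod.mk_eq_zero] at hf
  obtain ⟨hf1, hf2, hf3⟩ := hf
  have hf2' (i) : φ (br f (g i)) = 0 := congrFun hf2 i
  have hf3' (i j) : φ (br (br f (g i)) (g j)) = 0 := congrFun (congrFun hf3 i) j
  have hK1 (u : ℂ[X]) : φ (br f u) = 0 := by
    obtain ⟨c, k, hk, rfl⟩ := hdecomp u
    rw [map_add, map_add, map_sum, map_sum, hbr f k, hφ f k hf1 hk, add_zero]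
    exact Finset.sum_eq_zero fun i _ => by rw [map_smul, map_smul, hf2', smul_zero]
  have hK2 (u w : ℂ[X]) : φ (br (br f u) w) = 0 := by
    obtain ⟨c', k', hk', rfl⟩ := hdecomp w
    rw [map_add, map_add, map_sum, map_sum, hbr _ k', hφ _ k' (hK1 u) hk', add_zero]
    refine Finset.sum_eq_zero fun j _ => ?_
    obtain ⟨c, k, hk, rfl⟩ := hdecomp u
    -- By Jacobi, `[[f, k], g] = [f, [k, g]] - [k, [f, g]]`, and both terms lie in the kernel.
    have h2 : φ (br (br f k) (g j)) = 0 := by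
      simp only [hbr]
      rw [vectorFieldBracket_leibniz, map_sub, ← hbr f, hK1, zero_sub,
        hφ k (vectorFieldBracket m f (g j)) hk (hf2' j), neg_zero]
    rw [map_smul, map_smul, map_add, map_add, LinearMap.add_apply, map_add, h2, add_zero, map_sum,
      map_sum, LinearMap.sum_apply, map_sum, Finset.sum_eq_zero, smul_zero]
    intro i _
    rw [map_smul, map_smul, LinearMap.smul_apply, map_smul, hf3', smul_zero]
  have hideal (k : ℂ[X]) : φ ((X ^ m) ^ 2 * f * k) = 0 := by
    have h2 := congrArg φ (vectorFieldBracket_ideal m f k)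
    simp only [← hbr, map_add, map_sub, map_smul, hK2, smul_zero, sub_zero, add_zero] at h2
    exact (smul_eq_zero.mp h2.symm).resolve_left (by norm_num)
  let J : Ideal ℂ[X] :=
    { carrier := {f | ∀ k, φ ((X ^ m) ^ 2 * f * k) = 0}
      add_mem' := fun {a b} ha hb k => by rw [mul_add, add_mul, map_add, ha, hb, add_zero]
      zero_mem' := fun k => by simp
      smul_mem' := fun r a ha k => by
        rw [smul_eq_mul, show (X ^ m) ^ 2 * (r * a) * k = (X ^ m) ^ 2 * a * (r * k) by ring]
        exact ha _ }
  have hJ (a : ℂ[X]) (ha : a ∈ J) : X ^ m * derivative a ∈ J := by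
    intro k
    have h2 := h1 _ (ha k)
    have h3 := ha (2 * derivative (X ^ m) * k + X ^ m * derivative k)
    have h4 : (X ^ m) ^ 2 * (X ^ m * derivative a) * k = X ^ m * derivative ((X ^ m) ^ 2 * a * k) -
        (X ^ m) ^ 2 * a * (2 * derivative (X ^ m) * k + X ^ m * derivative k) := by
      generalize (X ^ m : ℂ[X]) = s
      simp only [derivative_mul, derivative_pow]
      simp [map_ofNat]
      ring
    rw [h4, map_sub, h2, h3, sub_zero]
  -- The ideal `J` is nonzero and stable under `t^m d/dt`, so its generator divides `t^m` times its
  -- own derivative and hence a power of `t`.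
  have hp0 : Submodule.IsPrincipal.generator J ≠ 0 := fun h0 => hf0 (by
    have : f ∈ J := hideal
    rwa [(Submodule.IsPrincipal.eq_bot_iff_generator_eq_zero J).mpr h0] at this)
  obtain ⟨N, hN⟩ := exists_dvd_X_pow hp0 ((Submodule.IsPrincipal.mem_iff_generator_dvd J).mp
    (hJ _ (Submodule.IsPrincipal.generator_mem J)))
  have hXN : X ^ N ∈ J := (Submodule.IsPrincipal.mem_iff_generator_dvd J).mpr hN
  refine ⟨m * 2 + N, fun k => ?_⟩
  rw [pow_add, pow_mul]
  exact hXN k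

variable {V : Type*} [AddCommGroup V] [Module ℂ V] [LieRingModule Vir V] [LieModule ℂ Vir V]

theorem IsLocallyFiniteEnd.exists_eigenvector {V : Type*} [AddCommGroup V] [Module ℂ V]
    [Nontrivial V] {f : Module.End ℂ V}
    (hf : IsLocallyFiniteEnd f) : ∃ (r : ℂ) (v : V), v ≠ 0 ∧ f v = r • v := by
  obtain ⟨w, hw⟩ := exists_ne (0 : V)
  obtain ⟨p, hp, hwp, hfp⟩ := hf w
  have : Nontrivial p := ⟨⟨w, hwp⟩, 0, fun h => hw (congrArg Subtype.val h)⟩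
  obtain ⟨r, hr⟩ := Module.End.exists_eigenvalue (f.restrict hfp)
  obtain ⟨v, hv⟩ := hr.exists_hasEigenvector
  exact ⟨r, v, fun h => hv.2 (Subtype.ext h), congrArg Subtype.val hv.apply_eq_smul⟩

/-- An eigenvector `v` of a single `d_n` works. All `d_(n+i) v` with `i ≥ 0` lie in one
finite-dimensional space, so the annihilator of `v` among these vector fields is a Lie algebra of
finite codimension. It is stable under bracketing with `d_n`, hence contains all `d_i` with `i`
large. -/
theorem exists_mem_eventuallyKilled [Nontrivial V] {K : ℕ}
    (hK : ∀ k : ℕ, K ≤ k → IsLocallyFiniteEnd (LieModule.toEnd ℂ Vir V (Vir.d k))) :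
    ∃ v : V, v ≠ 0 ∧ v ∈ eventuallyKilled V := by
  obtain ⟨n, hn, hKn⟩ : ∃ n : ℕ, 1 ≤ n ∧ K ≤ n := ⟨max 1 K, le_max_left _ _, le_max_right _ _⟩
  obtain ⟨r, v, hv, hrv⟩ := (hK n hKn).exists_eigenvector
  change ⁅Vir.d n, v⁆ = r • v at hrv
  -- For `i ≠ 0`, `d_(2n+i) v` is a multiple of `(d_n - r) d_(n+i) v`. At `i = 0` this gives
  -- nothing, so `d_n v, …, d_(2n) v` are the `n + 1` starting vectors.
  choose p hpfin hpmem hpstable using fun j : Fin (n + 1) =>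
    hK n hKn ⁅Vir.d ((n + j : ℕ) : ℤ), v⁆
  have hmem (i : ℕ) : ∃ j, ⁅Vir.d ((n + i : ℕ) : ℤ), v⁆ ∈ p j := by
    induction i using Nat.strong_induction_on with
    | _ i ih =>
      rcases Nat.lt_or_ge i (n + 1) with hi | hi
      · exact ⟨⟨i, hi⟩, hpmem ⟨i, hi⟩⟩
      · obtain ⟨i', rfl⟩ := Nat.exists_eq_add_of_le (show n ≤ i by omega)
        obtain ⟨j, hj⟩ := ih i' (by omega)
        refine ⟨j, ?_⟩
        have h1 := Vir.lie_d_d_of_pos (i := (n : ℤ)) (j := ((n + i' : ℕ) : ℤ)) (by omega) v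
        rw [hrv, lie_smul] at h1
        have h2 : (((n + i' : ℕ) : ℤ) : ℂ) - ((n : ℤ) : ℂ) = (i' : ℂ) := by push_cast; ring
        have hi' : (i' : ℂ) ≠ 0 := by
          have : i' ≠ 0 := by omega
          exact_mod_cast this
        have h3 : ⁅Vir.d ((n + (n + i') : ℕ) : ℤ), v⁆ = (i' : ℂ)⁻¹ •
            (⁅Vir.d n, ⁅Vir.d ((n + i' : ℕ) : ℤ), v⁆⁆ - r • ⁅Vir.d ((n + i' : ℕ) : ℤ), v⁆) := by
          rw [h1, h2, add_sub_cancel_left, smul_smul, inv_mul_cancel₀ hi', one_smul]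
          congr 2
        rw [h3]
        exact (p j).smul_mem _ ((p j).sub_mem (hpstable j _ hj) ((p j).smul_mem r hj))
  let φ : ℂ[X] →ₗ[ℂ] V := (LieModule.toEnd ℂ Vir V : Vir →ₗ[ℂ] Module.End ℂ V).flip v ∘ₗ virPoly n
  have hφ (f : ℂ[X]) : φ f = ⁅virPoly n f, v⁆ := rfl
  have hφP (f : ℂ[X]) : φ f ∈ ⨆ j, p j := by
    induction f using Polynomial.induction_on' with
    | add f g hf hg => rw [map_add]; exact add_mem hf hg
    | monomial i s =>
      obtain ⟨j, hj⟩ := hmem i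
      rw [hφ, virPoly_monomial, smul_lie]
      exact Submodule.smul_mem _ _ (Submodule.mem_iSup_of_mem j hj)
  have h0 (f : ℂ[X]) : φ.codRestrict _ hφP f = 0 ↔ φ f = 0 := Subtype.ext_iff
  obtain ⟨N, hN⟩ := exists_X_pow_mul_mem (φ.codRestrict _ hφP) (n + 1)
    (fun f g hf hg => by
      rw [h0] at hf hg ⊢
      rw [hφ] at hf hg ⊢
      rw [← virPoly_lie hn, lie_lie, hf, hg, lie_zero, lie_zero, sub_zero])
    (fun f hf => by
      rw [h0] at hf ⊢
      have h1 : X ^ (n + 1) * derivative f = vectorFieldBracket (n + 1) (monomial 0 1) f := by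
        simp [vectorFieldBracket]
      rw [hφ] at hf ⊢
      rw [h1, ← virPoly_lie hn, lie_lie, hf, lie_zero, virPoly_monomial, add_zero, one_smul, hrv,
        lie_smul, hf, smul_zero, sub_zero])
  refine ⟨v, hv, ((n + N : ℕ) : ℤ), fun i hi => ?_⟩
  obtain ⟨i, rfl⟩ := Int.eq_ofNat_of_zero_le (show 0 ≤ i by omega)
  obtain ⟨i, rfl⟩ := Nat.exists_eq_add_of_le (show n + N ≤ i by omega)
  have h1 := hN (X ^ i)
  rw [h0, hφ, ← pow_add, ← monomial_one_right_eq_X_pow, virPoly_monomial, one_smul,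
    ← add_assoc] at h1
  exact h1

end LocallyFinite

/-! ### A single factor against `A_b` and `N(M, γ)` -/

section SingleFactor

open Polynomial

theorem not_eventuallyEmbeds_omegaTriple_twist (l : ℂˣ) {α : ℂ} (hα : α ≠ 0) (h : ℂ[X]) (b : ℂ)
    (A : Type*) [AddCommGroup A] [Module ℂ A] [Module laurentDiffOps A]
    [IsScalarTower ℂ laurentDiffOps A] : ¬ EventuallyEmbeds (OmegaTriple l α h) (Twist b A) := by
  rintro ⟨j, R, hj, hR⟩
  obtain ⟨f, hf⟩ := exists_omegaTripleQuad_ne_zero hα h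
  have h1 := map_antiDiff_pow_lieLie hR 4 (C f : ℂ[X][X]) le_rfl le_rfl
  rw [antiDiff_pow_eq_zero_of_le (by norm_num : 3 ≤ 4) (antiDiff_pow_lieLie_twist b A _)] at h1
  have h2 := (injective_iff_map_eq_zero j).mp hj _ h1
  have h3 : (24 * ((l ^ (R + R + 4) : ℂˣ) : ℂ)) •
      (C (omegaTripleQuad α h (omegaTripleQuad α h f)) : ℂ[X][X]) = 0 :=
    (congrFun (congrFun (antiDiff_pow_lieLie_omegaTriple l α h f) R) R).symm.trans h2
  refine (smul_eq_zero.mp h3).elim (fun h4 => ?_) (fun h4 => hf (C_eq_zero.mp h4))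
  exact (mul_eq_zero.mp h4).elim (by norm_num) (l ^ (R + R + 4)).ne_zero

/-- In the target the top difference is the injective `loopLead` with `g = t^s`, where `s` grows by
1 with `x`. A scaling relation with ratio `r` says that `loopLead` with `g = (t - r) t^s` kills the
image of `a`, yet it is still injective. -/
theorem not_eventuallyEmbeds_loopModule {k : ℕ} (hk : 1 ≤ k) {M : Type*} [AddCommGroup M]
    [Module ℂ M] [LieRingModule (TruncatedVir k) M] [LieModule ℂ (TruncatedVir k) M]
    (hinj : Function.Injective (fun v : M => ⁅TruncatedVir.d k k, v⁆)) (γ : ℂ[T;T⁻¹]) {S : Type*}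
    [AddCommGroup S] [Module ℂ S] [LieRingModule Vir S] [LieModule ℂ Vir S] (r : ℂ) {a : S}
    (ha : a ≠ 0) (hr : ∀ x y, (antiDiff S ^ (k + 1 + (k + 1))) (lieLie S a) (x + 1) y =
      r • (antiDiff S ^ (k + 1 + (k + 1))) (lieLie S a) x y) :
    ¬ EventuallyEmbeds S (LoopModule k M γ) := by
  rintro ⟨j, R, hj, hR⟩
  have h1 := congrArg j (hr R R)
  rw [map_smul, map_antiDiff_pow_lieLie hR _ a (by omega) le_rfl,
    map_antiDiff_pow_lieLie hR _ a le_rfl le_rfl, antiDiff_pow_lieLie_loopModule k M γ hk] at h1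
  have h2 : loopScalar k • loopLead k M
        (LaurentPolynomial.T (R + 1 + R + (k + 1 + (k + 1) : ℕ))) (j a) =
      r • loopScalar k • loopLead k M
        (LaurentPolynomial.T (R + R + (k + 1 + (k + 1) : ℕ))) (j a) := h1
  generalize hs' : R + R + ((k + 1 + (k + 1) : ℕ) : ℤ) = s,
    hs : R + 1 + R + ((k + 1 + (k + 1) : ℕ) : ℤ) = s' at h2
  have hss : s' = 1 + s := by omega
  rw [smul_comm r] at h2
  have h3 := (smul_right_injective _ (loopScalar_ne_zero k)) h2
  have h4 : loopLead k M ((LaurentPolynomial.T 1 - LaurentPolynomial.C r) * LaurentPolynomial.T s)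
      (j a) = 0 := by
    have h5 (w : M ⊗[ℂ] ℂ[T;T⁻¹]) :
        loopLead k M ((LaurentPolynomial.T 1 - LaurentPolynomial.C r) * LaurentPolynomial.T s) w =
        loopLead k M (LaurentPolynomial.T (1 + s)) w -
          r • loopLead k M (LaurentPolynomial.T s) w := by
      induction w using TensorProduct.induction_on with
      | zero => simp
      | add x y hx hy => simp only [map_add, hx, hy, smul_add]; abel
      | tmul v f =>
        simp only [loopLead, TensorProduct.map_tmul, LinearMap.mulLeft_apply,
          ← TensorProduct.tmul_smul, ← TensorProduct.tmul_sub, LaurentPolynomial.T_add,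
          LaurentPolynomial.smul_eq_C_mul]
        congr 1
        ring
    refine (h5 _).trans (sub_eq_zero.mpr ?_)
    rw [← hss]
    exact h3
  have hT (s : ℤ) : (LaurentPolynomial.T s : ℂ[T;T⁻¹]) ≠ 0 := (LaurentPolynomial.isUnit_T s).ne_zero
  have hne : (LaurentPolynomial.T 1 - LaurentPolynomial.C r) * LaurentPolynomial.T s ≠
      (0 : ℂ[T;T⁻¹]) := by
    refine mul_ne_zero (fun h0 => ?_) (hT s)
    -- The operator `t d/dt` fixes `t` but kills constants, so `t ≠ r`.
    have h5 := congrArg euler (sub_eq_zero.mp h0)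
    rw [euler_T, ← mul_one (LaurentPolynomial.C r), ← LaurentPolynomial.smul_eq_C_mul, map_smul,
      ← LaurentPolynomial.T_zero, euler_T, Int.cast_zero, zero_smul, smul_zero, Int.cast_one,
      one_smul] at h5
    exact hT 1 h5
  have h5 : j a = 0 := loopLead_injective k M hinj hne (h4.trans (map_zero _).symm)
  exact ha ((injective_iff_map_eq_zero j).mp hj _ h5)

theorem not_eventuallyEmbeds_omegaPair_loopModule (μ : ℂˣ) (β : ℂ) {k : ℕ} (hk : 1 ≤ k) {M : Type*}
    [AddCommGroup M] [Module ℂ M] [LieRingModule (TruncatedVir k) M] [LieModule ℂ (TruncatedVir k) M]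
    (hinj : Function.Injective (fun v : M => ⁅TruncatedVir.d k k, v⁆)) (γ : ℂ[T;T⁻¹]) :
    ¬ EventuallyEmbeds (OmegaPair μ β) (LoopModule k M γ) := by
  refine not_eventuallyEmbeds_loopModule hk hinj γ 0 (a := (1 : ℂ[X])) (one_ne_zero (α := ℂ[X])) ?_
  intro x y
  have h1 := antiDiff_pow_eq_zero_of_le (by omega : 3 ≤ k + 1 + (k + 1))
    (antiDiff_pow_lieLie_omegaPair μ β (1 : ℂ[X]))
  rw [zero_smul]
  exact congrFun (congrFun h1 (x + 1)) y

theorem not_eventuallyEmbeds_omegaTriple_loopModule (l : ℂˣ) (α : ℂ) (h : ℂ[X]) {k : ℕ}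
    (hk : 1 ≤ k) {M : Type*} [AddCommGroup M] [Module ℂ M] [LieRingModule (TruncatedVir k) M]
    [LieModule ℂ (TruncatedVir k) M]
    (hinj : Function.Injective (fun v : M => ⁅TruncatedVir.d k k, v⁆)) (γ : ℂ[T;T⁻¹]) :
    ¬ EventuallyEmbeds (OmegaTriple l α h) (LoopModule k M γ) := by
  refine not_eventuallyEmbeds_loopModule hk hinj γ l (a := (C 1 : ℂ[X][X]))
    (C_ne_zero.mpr one_ne_zero : (C 1 : ℂ[X][X]) ≠ 0) ?_
  intro x y
  -- The fourth difference is proportional to `l^(x+y+4)`, and the remaining `i` differences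
  -- preserve the scaling by `l` in `x`.
  obtain ⟨i, hi⟩ : ∃ i, k + 1 + (k + 1) = i + 4 := ⟨2 * k - 2, by omega⟩
  let z : ℂ[X][X] := C (omegaTripleQuad α h (omegaTripleQuad α h 1))
  let G : ℤ → ℤ → OmegaTriple l α h := fun x y => (24 * ((l ^ (x + y + 4) : ℂˣ) : ℂ)) • z
  have h1 : (antiDiff (OmegaTriple l α h) ^ (k + 1 + (k + 1)))
      (lieLie (OmegaTriple l α h) (C 1 : ℂ[X][X])) = (antiDiff (OmegaTriple l α h) ^ i) G := by
    rw [hi, pow_add]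
    exact congrArg (antiDiff (OmegaTriple l α h) ^ i) (antiDiff_pow_lieLie_omegaTriple l α h 1)
  have h2 : (fun x y => G (x + 1) y) = (l : ℂ) • G := by
    funext x y
    change (24 * ((l ^ (x + 1 + y + 4) : ℂˣ) : ℂ)) • z =
      (l : ℂ) • (24 * ((l ^ (x + y + 4) : ℂˣ) : ℂ)) • z
    rw [smul_smul, show x + 1 + y + 4 = x + y + 4 + 1 by ring, zpow_add_one, Units.val_mul]
    congr 1
    ring
  have h3 := antiDiff_pow_shift_left i G x y
  rw [h2, map_smul] at h3
  rw [h1]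
  exact h3.symm

end SingleFactor

/-! ### The tensor product of `Ω(μ, β)` and `V` against `A_b` -/

section PairTensor

open Polynomial

variable {V : Type*} [AddCommGroup V] [Module ℂ V]

theorem antiDiff_pow_zpow_smul (μ : ℂˣ) (r : ℕ) (g : ℤ → V) (x y : ℤ) :
    (antiDiff V ^ r) (fun (x y : ℤ) => ((μ ^ x : ℂˣ) : ℂ) • g y) x y =
      ((μ ^ x : ℂˣ) : ℂ) • (fun (g : ℤ → V) (y : ℤ) => (μ : ℂ) • g y - g (y + 1))^[r] g y := by
  induction r generalizing g with
  | zero => rfl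
  | succ r ih =>
    rw [antiDiff_pow_succ, Function.iterate_succ_apply, ← ih]
    have : antiDiff V (fun (x y : ℤ) => ((μ ^ x : ℂˣ) : ℂ) • g y) =
        fun (x y : ℤ) => ((μ ^ x : ℂˣ) : ℂ) • ((μ : ℂ) • g y - g (y + 1)) := by
      funext x y
      simp only [antiDiff_apply, zpow_add_one, Units.val_mul, smul_sub, smul_smul]
    rw [this]

/-- A solution of `g(y + 1) = μ g(y)` that vanishes for large `y` vanishes everywhere by descent, as
`μ ≠ 0`. -/
theorem eq_zero_of_iterate_shift_eq_zero (μ : ℂˣ) (r : ℕ) {g : ℤ → V} {R : ℤ}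
    (hR : ∀ y, R ≤ y → g y = 0)
    (h : (fun (g : ℤ → V) (y : ℤ) => (μ : ℂ) • g y - g (y + 1))^[r] g = 0) : g = 0 := by
  induction r generalizing g with
  | zero => exact h
  | succ r ih =>
    rw [Function.iterate_succ_apply] at h
    have h1 := ih (fun y hy => by rw [hR y hy, hR (y + 1) (by omega), smul_zero, sub_zero]) h
    have h2 (i : ℕ) : g (R - i) = 0 := by
      induction i with
      | zero => exact hR _ (by simp)
      | succ i ih =>
        have h3 : (μ : ℂ) • g (R - (i + 1 : ℕ)) - g (R - (i + 1 : ℕ) + 1) = 0 :=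
          congrFun h1 (R - (i + 1 : ℕ))
        rw [show R - ((i + 1 : ℕ) : ℤ) + 1 = R - i by push_cast; ring, ih, sub_zero] at h3
        exact (smul_eq_zero.mp h3).resolve_left μ.ne_zero
    funext y
    rcases le_or_gt R y with hy | hy
    · exact hR y hy
    · have := h2 (R - y).toNat
      rwa [Int.toNat_of_nonneg (by omega), sub_sub_cancel] at this

variable [LieRingModule Vir V] [LieModule ℂ Vir V]

theorem lie_eq_zero_of_lie_d_eq_zero {v : V} (hv : ∀ i, ⁅Vir.d i, v⁆ = 0) (x : Vir) :
    ⁅x, v⁆ = 0 := by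
  have hc : ⁅Vir.c, v⁆ = 0 := by
    -- The bracket equals `-4 d_0 + c/2`, so `c` also acts as zero on `v`.
    have h1 : ⁅⁅Vir.d 2, Vir.d (-2)⁆, v⁆ = 0 := by rw [lie_lie, hv, hv, lie_zero, lie_zero, sub_zero]
    rw [Vir.lie_d_d, if_pos (by norm_num), add_lie, smul_lie, hv, smul_zero, zero_add, smul_lie] at h1
    exact (smul_eq_zero.mp h1).resolve_left (by norm_num)
  have hx : x ∈ Submodule.span ℂ (insert Vir.c (Set.range Vir.d)) := by
    rw [Vir.span_range_d_c]; trivial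
  induction hx using Submodule.span_induction with
  | mem x hx =>
    obtain rfl | ⟨i, rfl⟩ := hx
    · exact hc
    · exact hv i
  | zero => exact zero_lie v
  | add x y _ _ hx hy => rw [add_lie, hx, hy, add_zero]
  | smul r x _ hx => rw [smul_lie, hx, smul_zero]

theorem eventuallyKilled_eq_top [LieModule.IsIrreducible ℂ Vir V] {K : ℕ}
    (hK : ∀ k : ℕ, K ≤ k → IsLocallyFiniteEnd (LieModule.toEnd ℂ Vir V (Vir.d k))) :
    eventuallyKilled V = ⊤ := by
  have := LieModule.nontrivial_of_isIrreducible ℂ Vir V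
  obtain ⟨v, hv, hmem⟩ := exists_mem_eventuallyKilled hK
  refine (eq_bot_or_eq_top _).resolve_left fun h => hv ?_
  rw [h] at hmem
  exact (LieSubmodule.mem_bot v).mp hmem

theorem finiteDimensional_of_lie_d_eq_zero [LieModule.IsIrreducible ℂ Vir V]
    (h : ∀ i, ∀ v : V, ⁅Vir.d i, v⁆ = 0) : FiniteDimensional ℂ V := by
  have := LieModule.nontrivial_of_isIrreducible ℂ Vir V
  obtain ⟨v, hv⟩ := exists_ne (0 : V)
  let P : LieSubmodule ℂ Vir V :=
    { ℂ ∙ v with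
      lie_mem := fun {x w} _ => by
        rw [lie_eq_zero_of_lie_d_eq_zero (fun i => h i w) x]
        exact Submodule.zero_mem (ℂ ∙ v) }
  have hP : P = ⊤ := (eq_bot_or_eq_top P).resolve_left fun hbot => hv (by
    have : v ∈ P := Submodule.mem_span_singleton_self v
    rwa [hbot, LieSubmodule.mem_bot] at this)
  refine ⟨⟨{v}, ?_⟩⟩
  rw [Finset.coe_singleton]
  exact congrArg LieSubmodule.toSubmodule hP

/-- Expand `d_x d_y (1 ⊗ v)` with `x` so large that `d_x v = 0`, and apply the coefficient of `∂` to
the first factor. The term acting on `1` alone dies after three differences and what remains is `μ^x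
d_y v`. As `y` runs over all of `ℤ`, this forces `d_y v = 0` for every `y`, so a homomorphism for
all of `Vir` is needed here. -/
theorem finiteDimensional_of_omegaPair_tensor_hom [LieModule.IsIrreducible ℂ Vir V]
    (hV : eventuallyKilled V = ⊤) {μ : ℂˣ} {β : ℂ} {b : ℂ} {A : Type*} [AddCommGroup A] [Module ℂ A]
    [Module laurentDiffOps A] [IsScalarTower ℂ laurentDiffOps A]
    (H : OmegaPair μ β ⊗[ℂ] V →ₗ⁅ℂ, Vir⁆ Twist b A) (hH : Function.Injective H) :
    FiniteDimensional ℂ V := by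
  have hrel (z : OmegaPair μ β ⊗[ℂ] V) (x y : ℤ) :
      (antiDiff (OmegaPair μ β ⊗[ℂ] V) ^ 3) (lieLie (OmegaPair μ β ⊗[ℂ] V) z) x y = 0 := by
    refine hH ?_
    have h1 := map_antiDiff_pow_lieLie (j := (H : OmegaPair μ β ⊗[ℂ] V →ₗ[ℂ] Twist b A))
      (R := min x y) (fun i _ a => LieModuleHom.map_lie H _ a) 3 z (min_le_left x y)
      (min_le_right x y)
    rw [antiDiff_pow_lieLie_twist] at h1
    exact h1.trans (map_zero H).symm
  let χ : OmegaPair μ β →ₗ[ℂ] ℂ := lcoeff ℂ 1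
  let e : OmegaPair μ β := (1 : ℂ[X])
  have hχe : χ e = 0 := by
    change (1 : ℂ[X]).coeff 1 = 0
    simp [coeff_one]
  have hχ (x : ℤ) : χ ⁅Vir.d x, e⁆ = ((μ ^ x : ℂˣ) : ℂ) := by
    refine (congrArg (fun p : ℂ[X] => p.coeff 1) (OmegaPair.lie_d μ β x (1 : ℂ[X]))).trans ?_
    rw [omegaPairAction_apply]
    simp [-map_mul]
  let Θ : OmegaPair μ β ⊗[ℂ] V →ₗ[ℂ] V := (TensorProduct.lid ℂ V : ℂ ⊗[ℂ] V →ₗ[ℂ] V) ∘ₗ χ.rTensor V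
  have hΘ (a : OmegaPair μ β) (w : V) : Θ (a ⊗ₜ w) = χ a • w := by simp [Θ]
  refine finiteDimensional_of_lie_d_eq_zero fun i v => ?_
  obtain ⟨R, hR⟩ : v ∈ eventuallyKilled V := by rw [hV]; trivial
  refine congrFun (eq_zero_of_iterate_shift_eq_zero μ 3 (g := fun y => ⁅Vir.d y, v⁆) hR
    (funext fun y => ?_)) i
  have h1 := congrArg Θ (hrel (e ⊗ₜ v) R y)
  rw [map_zero, ← antiDiff_pow_map] at h1
  have h2 : ∀ x' y', R ≤ x' → y ≤ y' → Θ (lieLie (OmegaPair μ β ⊗[ℂ] V) (e ⊗ₜ v) x' y') =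
      ((fun (x y : ℤ) => (Θ ∘ₗ (TensorProduct.mk ℂ (OmegaPair μ β) V).flip v)
        (lieLie (OmegaPair μ β) e x y)) +
        fun (x y : ℤ) => ((μ ^ x : ℂˣ) : ℂ) • ⁅Vir.d y, v⁆ : ℤ → ℤ → V) x' y' := by
    intro x' y' hx' _
    simp only [lieLie_apply, TensorProduct.LieModule.lie_tmul_right, lie_add, map_add, hΘ, hR x' hx',
      hχe, hχ, zero_smul, smul_zero, add_zero, Pi.add_apply, LinearMap.comp_apply,
      LinearMap.flip_apply, TensorProduct.mk_apply]
  rw [antiDiff_pow_congr 3 h2 R y le_rfl le_rfl, map_add, Pi.add_apply, Pi.add_apply,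
    antiDiff_pow_map, antiDiff_pow_lieLie_omegaPair, Pi.zero_apply, Pi.zero_apply, map_zero,
    zero_add, antiDiff_pow_zpow_smul] at h1
  exact (smul_eq_zero.mp h1).resolve_left (μ ^ R).ne_zero

end PairTensor

/-! ### Assembling the cases for `T` -/

section OmegaTensor

theorem lieModuleMap_id_injective {L M P V : Type*} [LieRing L] [LieAlgebra ℂ L] [AddCommGroup M]
    [Module ℂ M] [LieRingModule L M] [LieModule ℂ L M] [AddCommGroup P] [Module ℂ P]
    [LieRingModule L P] [LieModule ℂ L P] [AddCommGroup V] [Module ℂ V] [LieRingModule L V]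
    [LieModule ℂ L V] (κ : M →ₗ⁅ℂ, L⁆ P) (hκ : Function.Injective κ) :
    Function.Injective (TensorProduct.LieModule.map κ (LieModuleHom.id (R := ℂ) (L := L) (M := V))) :=
  TensorProduct.map_injective_of_flat_flat (κ : M →ₗ[ℂ] P) LinearMap.id hκ Function.injective_id

variable {m n : ℕ} (l : Fin m → ℂˣ) (α : Fin m → ℂ) (h : Fin m → ℂ[X]) (μ : Fin n → ℂˣ)
  (β : Fin n → ℂ)

theorem eventuallyEmbeds_omegaTriple_omegaTensor [Subsingleton (Fin m ⊕ Fin n)] (i : Fin m) :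
    EventuallyEmbeds (OmegaTriple (l i) (α i) (h i)) (OmegaTensor l α h μ β) := by
  have h1 : EventuallyEmbeds (OmegaFactor l α h μ β (Sum.inl i)) (⨂[ℂ] i, OmegaFactor l α h μ β i) :=
    ⟨factorEmb (fun _ => 0) (Sum.inl i), 0, factorEmb_injective _ _,
      fun x _ a => factorEmb_lie _ _ _ a⟩
  exact h1.trans (omegaTensorEquiv l α h μ β).eventuallyEmbeds

theorem exists_omegaPair_hom_omegaTensor [Subsingleton (Fin m ⊕ Fin n)] (j : Fin n) :
    ∃ κ : OmegaPair (μ j) (β j) →ₗ⁅ℂ, Vir⁆ OmegaTensor l α h μ β, Function.Injective κ := by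
  let κ : OmegaFactor l α h μ β (Sum.inr j) →ₗ⁅ℂ, Vir⁆ (⨂[ℂ] i, OmegaFactor l α h μ β i) :=
    { factorEmb (fun _ => 0) (Sum.inr j) with
      map_lie' := fun {x a} => factorEmb_lie _ _ x a }
  have hκ : Function.Injective κ := factorEmb_injective _ (Sum.inr j)
  let e : (⨂[ℂ] i, OmegaFactor l α h μ β i) →ₗ⁅ℂ, Vir⁆ OmegaTensor l α h μ β :=
    omegaTensorEquiv l α h μ β
  have he : Function.Injective e := (omegaTensorEquiv l α h μ β).injective
  exact ⟨e.comp κ, he.comp hκ⟩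

theorem eventuallyEmbeds_omegaPair_omegaTensor [Subsingleton (Fin m ⊕ Fin n)] (j : Fin n) :
    EventuallyEmbeds (OmegaPair (μ j) (β j)) (OmegaTensor l α h μ β) := by
  obtain ⟨κ, hκ⟩ := exists_omegaPair_hom_omegaTensor l α h μ β j
  exact ⟨κ, 0, hκ, fun x _ a => LieModuleHom.map_lie κ _ a⟩

variable {l α h μ β} {W : Type*} [AddCommGroup W] [Module ℂ W] [LieRingModule Vir W]
  [LieModule ℂ Vir W]

theorem not_eventuallyEmbeds_omegaTensor_of_antiDiff [Nontrivial (Fin m ⊕ Fin n)]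
    (hα : ∀ i, α i ≠ 0) (hβ : ∀ j, β j ≠ 0) {r : ℕ} (hr : Odd r)
    (hW : ∀ w : W, (antiDiff W ^ r) (lieLie W w) = 0) :
    ¬ EventuallyEmbeds (OmegaTensor l α h μ β) W := by
  intro hemb
  obtain ⟨j, R, hj, hR⟩ := (omegaTensorEquiv l α h μ β).eventuallyEmbeds.trans hemb
  refine not_antiDiff_pow_lieLie_eq_zero (exists_omegaLike_omegaFactor l α h μ β hα hβ) hr (R := R)
    fun a x y hx hy => hj ?_
  rw [map_antiDiff_pow_lieLie hR r a hx hy, hW, map_zero]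
  rfl

theorem not_eventuallyEmbeds_omegaTensor_inducedTheta (hmn : 1 ≤ m + n) (hα : ∀ i, α i ≠ 0)
    (hβ : ∀ j, β j ≠ 0) {N : Type*} [AddCommGroup N] [Module ℂ N] [LieRingModule VirPlus N]
    [LieModule ℂ VirPlus N] {k : ℕ} (hk : ∀ i : ℕ, k < i → ∀ v : N, ⁅VirPlus.d i, v⁆ = 0) (θ : ℂ) :
    ¬ EventuallyEmbeds (OmegaTensor l α h μ β) (InducedTheta N θ) := by
  intro hemb
  have : Nonempty (Fin m ⊕ Fin n) := Fintype.card_pos_iff.mp (by simp; omega)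
  exact not_eventuallyEmbeds_of_eventuallyKilled
    (exists_lie_d_ne_zero (exists_omegaLike_omegaFactor l α h μ β hα hβ))
    (InducedTheta.mem_eventuallyKilled hk θ)
    ((omegaTensorEquiv l α h μ β).eventuallyEmbeds.trans hemb)

theorem not_eventuallyEmbeds_omegaTensor_twist (hmn : 1 ≤ m ∨ 2 ≤ n) (hα : ∀ i, α i ≠ 0)
    (hβ : ∀ j, β j ≠ 0) (b : ℂ) (A : Type*) [AddCommGroup A] [Module ℂ A] [Module laurentDiffOps A]
    [IsScalarTower ℂ laurentDiffOps A] :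
    ¬ EventuallyEmbeds (OmegaTensor l α h μ β) (Twist b A) := by
  intro hemb
  rcases subsingleton_or_nontrivial (Fin m ⊕ Fin n) with hs | hs
  · have hcard : m + n ≤ 1 := by simpa using Fintype.card_le_one_iff_subsingleton.mpr hs
    exact not_eventuallyEmbeds_omegaTriple_twist _ (hα ⟨0, by omega⟩) _ b A
      ((eventuallyEmbeds_omegaTriple_omegaTensor l α h μ β ⟨0, by omega⟩).trans hemb)
  · exact not_eventuallyEmbeds_omegaTensor_of_antiDiff hα hβ (r := 3) (by decide)
      (antiDiff_pow_lieLie_twist b A) hemb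

theorem not_eventuallyEmbeds_omegaTensor_loopModule (hmn : 1 ≤ m + n) (hα : ∀ i, α i ≠ 0)
    (hβ : ∀ j, β j ≠ 0) {k : ℕ} (hk : 1 ≤ k) {M : Type*} [AddCommGroup M] [Module ℂ M]
    [LieRingModule (TruncatedVir k) M] [LieModule ℂ (TruncatedVir k) M]
    (hinj : Function.Injective (fun v : M => ⁅TruncatedVir.d k k, v⁆)) (γ : ℂ[T;T⁻¹]) :
    ¬ EventuallyEmbeds (OmegaTensor l α h μ β) (LoopModule k M γ) := by
  intro hemb
  rcases subsingleton_or_nontrivial (Fin m ⊕ Fin n) with hs | hs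
  · rcases Nat.eq_zero_or_pos m with hm | hm
    · exact not_eventuallyEmbeds_omegaPair_loopModule _ _ hk hinj γ
        ((eventuallyEmbeds_omegaPair_omegaTensor l α h μ β ⟨0, by omega⟩).trans hemb)
    · exact not_eventuallyEmbeds_omegaTriple_loopModule _ _ _ hk hinj γ
        ((eventuallyEmbeds_omegaTriple_omegaTensor l α h μ β ⟨0, hm⟩).trans hemb)
  -- The difference of order `2k + 2` depends on `x + y` only, so one more kills it, and `2k + 3` is
  -- odd as required.
  · refine not_eventuallyEmbeds_omegaTensor_of_antiDiff hα hβ (r := k + 1 + (k + 1) + 1)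
      (Even.add_one ⟨k + 1, rfl⟩) (fun w => ?_) hemb
    rw [pow_succ', Module.End.mul_apply, antiDiff_pow_lieLie_loopModule k M γ hk]
    exact antiDiff_diagonal fun s => loopScalar k •
      loopLead k M (LaurentPolynomial.T (s + (k + 1 + (k + 1) : ℕ))) w

end OmegaTensor

end

theorem theorem5p2 {m n : ℕ} (hmn : 1 ≤ m + n)
    (l : Fin m → ℂˣ) (α : Fin m → ℂ) (hα : ∀ i, α i ≠ 0) (h : Fin m → ℂ[X])
    (μ : Fin n → ℂˣ) (β : Fin n → ℂ) (hβ : ∀ j, β j ≠ 0) :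
    ((∀ (N : Type*) [AddCommGroup N] [Module ℂ N] [LieRingModule VirPlus N]
          [LieModule ℂ VirPlus N] [LieModule.IsIrreducible ℂ VirPlus N] (k : ℕ), 1 ≤ k →
          Function.Injective (fun v : N => ⁅VirPlus.d k, v⁆) →
          (∀ i : ℕ, k < i → ∀ v : N, ⁅VirPlus.d i, v⁆ = 0) →
          ∀ θ : ℂ, IsEmpty (OmegaTensor l α h μ β ≃ₗ⁅ℂ, Vir⁆ InducedTheta N θ)) ∧
      (1 ≤ m ∨ 2 ≤ n →
        ∀ (b : ℂ) (A : Type*) [AddCommGroup A] [Module ℂ A] [Module laurentDiffOps A]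
          [IsScalarTower ℂ laurentDiffOps A],
          IsEmpty (OmegaTensor l α h μ β ≃ₗ⁅ℂ, Vir⁆ Twist b A)) ∧
      (∀ (k : ℕ), 1 ≤ k → ∀ (M : Type*) [AddCommGroup M] [Module ℂ M]
          [LieRingModule (TruncatedVir k) M] [LieModule ℂ (TruncatedVir k) M]
          [LieModule.IsIrreducible ℂ (TruncatedVir k) M],
          Function.Injective (fun v : M => ⁅TruncatedVir.d k k, v⁆) →
          ∀ γ : ℂ[T;T⁻¹], IsEmpty (OmegaTensor l α h μ β ≃ₗ⁅ℂ, Vir⁆ LoopModule k M γ))) ∧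
    ∀ (V : Type*) [AddCommGroup V] [Module ℂ V] [LieRingModule Vir V] [LieModule ℂ Vir V]
      [LieModule.IsIrreducible ℂ Vir V],
      (∃ K : ℕ, ∀ k : ℕ, K ≤ k → IsLocallyFiniteEnd (LieModule.toEnd ℂ Vir V (Vir.d k))) →
      (∀ (N : Type*) [AddCommGroup N] [Module ℂ N] [LieRingModule VirPlus N]
          [LieModule ℂ VirPlus N] [LieModule.IsIrreducible ℂ VirPlus N] (k : ℕ), 1 ≤ k →
          Function.Injective (fun v : N => ⁅VirPlus.d k, v⁆) →
          (∀ i : ℕ, k < i → ∀ v : N, ⁅VirPlus.d i, v⁆ = 0) →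
          ∀ θ : ℂ, IsEmpty (OmegaTensor l α h μ β ⊗[ℂ] V ≃ₗ⁅ℂ, Vir⁆ InducedTheta N θ)) ∧
      (1 ≤ m ∨ 2 ≤ n ∨ ¬ FiniteDimensional ℂ V →
        ∀ (b : ℂ) (A : Type*) [AddCommGroup A] [Module ℂ A] [Module laurentDiffOps A]
          [IsScalarTower ℂ laurentDiffOps A],
          IsEmpty (OmegaTensor l α h μ β ⊗[ℂ] V ≃ₗ⁅ℂ, Vir⁆ Twist b A)) ∧
      (∀ (k : ℕ), 1 ≤ k → ∀ (M : Type*) [AddCommGroup M] [Module ℂ M]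
          [LieRingModule (TruncatedVir k) M] [LieModule ℂ (TruncatedVir k) M]
          [LieModule.IsIrreducible ℂ (TruncatedVir k) M],
          Function.Injective (fun v : M => ⁅TruncatedVir.d k k, v⁆) →
          ∀ γ : ℂ[T;T⁻¹], IsEmpty (OmegaTensor l α h μ β ⊗[ℂ] V ≃ₗ⁅ℂ, Vir⁆ LoopModule k M γ)) := by

  refine ⟨⟨fun N _ _ _ _ _ k _ _ hk θ => ⟨fun e => ?_⟩, fun hmn' b A _ _ _ _ => ⟨fun e => ?_⟩,
    fun k hk M _ _ _ _ _ hinj γ => ⟨fun e => ?_⟩⟩, fun V _ _ _ _ _ ⟨K, hK⟩ => ?_⟩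
  · exact not_eventuallyEmbeds_omegaTensor_inducedTheta hmn hα hβ hk θ e.eventuallyEmbeds
  · exact not_eventuallyEmbeds_omegaTensor_twist hmn' hα hβ b A e.eventuallyEmbeds
  · exact not_eventuallyEmbeds_omegaTensor_loopModule hmn hα hβ hk hinj γ e.eventuallyEmbeds
  have hV := eventuallyKilled_eq_top hK
  -- Through this embedding every case except `m = 0`, `n = 1` against `A_b` reduces to the
  -- statement for `T` alone.
  have hemb : EventuallyEmbeds (OmegaTensor l α h μ β) (OmegaTensor l α h μ β ⊗[ℂ] V) := by
    have := LieModule.nontrivial_of_isIrreducible ℂ Vir V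
    obtain ⟨v, hv, R, hR⟩ := exists_mem_eventuallyKilled hK
    exact eventuallyEmbeds_of_tensor hv hR
  refine ⟨fun N _ _ _ _ _ k _ _ hk θ => ⟨fun e => ?_⟩, fun hmn' b A _ _ _ _ => ⟨fun e => ?_⟩,
    fun k hk M _ _ _ _ _ hinj γ => ⟨fun e => ?_⟩⟩
  · exact not_eventuallyEmbeds_omegaTensor_inducedTheta hmn hα hβ hk θ
      (hemb.trans e.eventuallyEmbeds)
  · by_cases hmn'' : 1 ≤ m ∨ 2 ≤ n
    · exact not_eventuallyEmbeds_omegaTensor_twist hmn'' hα hβ b A (hemb.trans e.eventuallyEmbeds)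
    · have : Subsingleton (Fin m ⊕ Fin n) :=
        Fintype.card_le_one_iff_subsingleton.mp (by simp; omega)
      obtain ⟨κ, hκ⟩ := exists_omegaPair_hom_omegaTensor l α h μ β ⟨0, by omega⟩
      refine absurd ?_ ((hmn'.resolve_left fun h1 => hmn'' (Or.inl h1)).resolve_left
        fun h1 => hmn'' (Or.inr h1))
      let κV := TensorProduct.LieModule.map κ (LieModuleHom.id (R := ℂ) (L := Vir) (M := V))
      have hκV : Function.Injective κV := lieModuleMap_id_injective κ hκ
      let e' : OmegaTensor l α h μ β ⊗[ℂ] V →ₗ⁅ℂ, Vir⁆ Twist b A := e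
      have he' : Function.Injective e' := e.injective
      exact finiteDimensional_of_omegaPair_tensor_hom hV (e'.comp κV) (he'.comp hκV)
  · exact not_eventuallyEmbeds_omegaTensor_loopModule hmn hα hβ hk hinj γ
      (hemb.trans e.eventuallyEmbeds)
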